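/- Setting. Let $\Omega$ be a measurable space with a measure $\nu$, let $p$ be a probability density with respect to $\nu$ (the actual distribution $P=p\,\nu$), and for every parameter $\theta\in\Theta$ let $q_\theta$ be a probability density with respect to $\nu$ (the counterfactual distribution $P^\theta=q_\theta\,\nu$). Let $\ell:\Omega\to[0,M]$ be measurable, $M>0$, and let $R>0$. Put $\bar w_\theta(\omega)=q_\theta(\omega)/p(\omega)$ if $q_\theta(\omega)<R\,p(\omega)$; otherwise put $\bar w_\theta(\omega)=0$ (clipped weights) or, throughout instead, $\bar w_\theta(\omega)=R$ (capped weights). The result holds for both choices. Write $$Y^\theta=\int \ell\,dP^\theta,\qquad \bar Y^\theta=\int \ell\,\bar w_\theta\,dP,$$ and, for $\omega_1,\dots,\omega_n$ i.i.d. from $P$, $$\widehat Y^\theta=\frac1n\sum_{i=1}^n\ell(\omega_i)\bar w_\theta(\omega_i),\qquad \widehat W^\theta=\frac1n\sum_{i=1}^n\bar w_\theta(\omega_i).$$ Let $\widehat V^\theta$ and $\widehat V_w^\theta$ be the sample variances (normalized by $n-1$) of the $\ell(\omega_i)\bar w_\theta(\omega_i)$ and of the $\bar w_\theta(\omega_i)$.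 For $F\subseteq\Theta$ and functions $\epsilon,\xi$ of $\theta$ and of the sample, say that the intervals are valid on $F$ if for all $\theta\in F$ $$|\widehat Y^\theta-\bar Y^\theta|\le\epsilon_\theta,\qquad \bar Y^\theta\le Y^\theta\le\bar Y^\theta+M(1-\widehat W^\theta+\xi_\theta),$$ $$\widehat Y^\theta-\epsilon_\theta\;\le\;Y^\theta\;\le\;\widehat Y^\theta+M(1-\widehat W^\theta+\xi_\theta)+\epsilon_\theta,$$ and if moreover every $\theta^*\in F$ that maximizes $\widehat Y^\theta$ over $F$ satisfies $$Y^{\theta^*}\ge \bar Y^{\theta}-\epsilon_\theta-\epsilon_{\theta^*}\qquad\text{for all }\theta\in F.$$ (1) Finite families. Let $F$ be finite, $n\ge2$, $\delta>0$, and $$\epsilon_\theta=\sqrt{\frac{2\widehat V^\theta\log(6/\delta)}{n}}+MR\,\frac{7\log(6/\delta)}{3(n-1)},\qquad \xi_\theta=\sqrt{\frac{2\widehat V_w^\theta\log(6/\delta)}{n}}+R\,\frac{7\log(6/\delta)}{3(n-1)}.$$ Then the (outer) probability that the intervals are not valid on $F$ is at most $|F|\,\delta$. If $\delta\le1$, then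 on every sample and for every $\theta$, $\epsilon_\theta\le 7MR\log(6/\delta)/\sqrt n$ and $\xi_\theta\le 7R\log(6/\delta)/\sqrt n$. (2) Arbitrary families. For a class $\mathcal H$ of functions $\Omega\to\mathbb R$ and $x\in\Omega^m$ let $\mathcal H(x)=\{(h(x_1),\dots,h(x_m)):h\in\mathcal H\}$, let $\mathcal N(x,r,\mathcal H)$ be the least cardinality of a set $C\subseteq\mathcal H(x)$ such that every $v\in\mathcal H(x)$ has some $c\in C$ with $\max_i|v_i-c_i|\le r$, and let $\mathcal N(m,r,\mathcal H)=\sup_{x\in\Omega^m}\mathcal N(x,r,\mathcal H)$. Let $\mathcal H=\{\ell\bar w_\theta,\ \bar w_\theta:\theta\in F\}$, and assume that each of the classes $\mathcal K=\{\ell\bar w_\theta:\theta\in F\}$ and $\mathcal K=\{\bar w_\theta:\theta\in F\}$ is empirically measurable: for all $m$ and all open $U\subseteq\mathbb R^m$ the set $\{x\in\Omega^m:\mathcal K(x)\cap U\ne\emptyset\}$ is measurable up to $P^{m}$-null sets. Let $n\ge16$, $\delta>0$, and $$\epsilon_\theta=\sqrt{\frac{18\widehat V^\theta\log(3/\delta)}{n}}+MR\,\frac{15\log(3/\delta)}{n-1},\qquad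 \xi_\theta=\sqrt{\frac{18\widehat V_w^\theta\log(3/\delta)}{n}}+R\,\frac{15\log(3/\delta)}{n-1}.$$ Then for every resolution $r\ge0$ with $r\le\min\{R,MR\}/n$ (in particular for $r=1/n$ when $R\ge1$ and $MR\ge1$), the (outer) probability that the intervals are not valid on $F$ is at most $\mathcal M(n)\,\delta$ with $\mathcal M(n)=10\,\mathcal N(2n,r,\mathcal H)\in[0,\infty]$. If $\delta\le1$, then on every sample and for every $\theta$, $\epsilon_\theta\le 7MR\log(3/\delta)/\sqrt n$ and $\xi_\theta\le 7R\log(3/\delta)/\sqrt n$. -/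

import Mathlib

open MeasureTheory ProbabilityTheory
open scoped NNReal ENNReal

noncomputable section

namespace Counterfactual

/-! ### Covering numbers of function classes -/

section Capacity

variable {Ω : Type*}

/-- The trace of a class `H` of real functions on the points `x 0, …, x (m - 1)`. -/
def trace (H : Set (Ω → ℝ)) {m : ℕ} (x : Fin m → Ω) : Set (Fin m → ℝ) :=
  (fun f i => f (x i)) '' H

/-- The growth function: the supremum over `m`-point configurations of the (internal) covering
number, at resolution `r` and for the maximum distance on `Fin m → ℝ`, of the trace. -/
def growthFunction (m : ℕ) (r : ℝ≥0) (H : Set (Ω → ℝ)) : ℕ∞ :=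
  ⨆ x : Fin m → Ω, Metric.coveringNumber r (trace H x)

/-- Measurability of suprema over the class: whether some trace vector of an independent
`P`-sample lies in a given open set is an event, up to `P`-null sets.  Automatic for countable
classes of measurable functions and for pointwise limits of sequences from a countable subclass. -/
def EmpiricallyMeasurable [MeasurableSpace Ω] (P : Measure Ω) (H : Set (Ω → ℝ)) : Prop :=
  ∀ (m : ℕ) (U : Set (Fin m → ℝ)), IsOpen U →
    NullMeasurableSet {x : Fin m → Ω | (trace H x ∩ U).Nonempty} (Measure.pi fun _ => P)

end Capacity

/-! ### Sample statistics and width functions -/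

def sampleMean {n : ℕ} (u : Fin n → ℝ) : ℝ := (∑ i, u i) / n

def sampleVariance {n : ℕ} (u : Fin n → ℝ) : ℝ :=
  (∑ i, (u i - sampleMean u) ^ 2) / ((n : ℝ) - 1)

/-- Width of the empirical Bernstein bound, for a sample `u` of a variable whose range has
length `b`, at failure probability `δ`. -/
def bernsteinWidth {n : ℕ} (b δ : ℝ) (u : Fin n → ℝ) : ℝ :=
  √(2 * sampleVariance u * Real.log (2 / δ) / n) + b * (7 * Real.log (2 / δ) / (3 * ((n : ℝ) - 1)))

/-- Width of the uniform empirical Bernstein bound, for a class of functions whose range has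
length `b`; the failure probability is the capacity of the class multiplied by `δ`. -/
def uniformBernsteinWidth {n : ℕ} (b δ : ℝ) (u : Fin n → ℝ) : ℝ :=
  √(18 * sampleVariance u * Real.log (1 / δ) / n) + b * (15 * Real.log (1 / δ) / ((n : ℝ) - 1))

/-! ### Counterfactual estimation with bounded importance weights -/

/-- `p` is a probability density with respect to `ν`. -/
structure IsDensity {Ω : Type*} [MeasurableSpace Ω] (ν : Measure Ω) (p : Ω → ℝ) : Prop where
  measurable : Measurable p
  nonneg : ∀ ω, 0 ≤ p ω
  lintegral_eq_one : ∫⁻ ω, ENNReal.ofReal (p ω) ∂ν = 1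

/-- What is done with the ratios that are not smaller than `R`: a *clipped* weight replaces them
by `0`, a *capped* weight replaces them by `R`. -/
inductive WeightRule
  | clipped
  | capped

/-- The importance weight `w = q / p`, clipped or capped at `R`.  Where `p` vanishes the ratio
counts as not smaller than `R`. -/
def boundedWeight {Ω : Type*} (rule : WeightRule) (R : ℝ) (p q : Ω → ℝ) (ω : Ω) : ℝ :=
  if q ω < R * p ω then q ω / p ω
  else match rule with
    | .clipped => 0
    | .capped => R

/-- The counterfactual problem: the actual density `p`, the counterfactual density `q θ` for each
parameter `θ`, a quantity of interest `ℓ` with values in `[0, M]`, and a maximal weight `R`. -/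
structure Setup (Ω Θ : Type*) [MeasurableSpace Ω] where
  ν : Measure Ω
  p : Ω → ℝ
  q : Θ → Ω → ℝ
  ℓ : Ω → ℝ
  M : ℝ
  R : ℝ
  rule : WeightRule
  density_p : IsDensity ν p
  density_q : ∀ θ, IsDensity ν (q θ)
  measurable_ℓ : Measurable ℓ
  ℓ_mem : ∀ ω, ℓ ω ∈ Set.Icc 0 M
  M_pos : 0 < M
  R_pos : 0 < R

namespace Setup

variable {Ω Θ : Type*} [MeasurableSpace Ω] (𝒮 : Setup Ω Θ)

/-- The actual distribution. -/
def P : Measure Ω := 𝒮.ν.withDensity fun ω => ENNReal.ofReal (𝒮.p ω)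

/-- The counterfactual distribution. -/
def Q (θ : Θ) : Measure Ω := 𝒮.ν.withDensity fun ω => ENNReal.ofReal (𝒮.q θ ω)

/-- The bounded weight `w̄_θ`. -/
def weight (θ : Θ) : Ω → ℝ := boundedWeight 𝒮.rule 𝒮.R 𝒮.p (𝒮.q θ)

/-- The weighted quantity `ℓ w̄_θ`. -/
def weightedValue (θ : Θ) (ω : Ω) : ℝ := 𝒮.ℓ ω * 𝒮.weight θ ω

/-- The counterfactual expectation `Y^θ`. -/
def Y (θ : Θ) : ℝ := ∫ ω, 𝒮.ℓ ω ∂(𝒮.Q θ)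

/-- The clipped (or capped) expectation, a lower bound of `Y^θ`. -/
def Ybar (θ : Θ) : ℝ := ∫ ω, 𝒮.weightedValue θ ω ∂𝒮.P

variable {n : ℕ} (x : Fin n → Ω)

/-- The empirical estimate of `Ybar`. -/
def Yhat (θ : Θ) : ℝ := sampleMean fun i => 𝒮.weightedValue θ (x i)

/-- The empirical estimate of the expected weight. -/
def What (θ : Θ) : ℝ := sampleMean fun i => 𝒮.weight θ (x i)

/-- Outer and inner half-widths for one parameter.  Three one-sided bounds are used, each at
failure probability `δ / 3`. -/
def outerWidth (δ : ℝ) (θ : Θ) : ℝ :=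
  bernsteinWidth (𝒮.M * 𝒮.R) (δ / 3) fun i => 𝒮.weightedValue θ (x i)

def innerWidth (δ : ℝ) (θ : Θ) : ℝ :=
  bernsteinWidth 𝒮.R (δ / 3) fun i => 𝒮.weight θ (x i)

/-- Outer and inner half-widths from the uniform bound, each one-sided bound at `δ / 3`. -/
def uniformOuterWidth (δ : ℝ) (θ : Θ) : ℝ :=
  uniformBernsteinWidth (𝒮.M * 𝒮.R) (δ / 3) fun i => 𝒮.weightedValue θ (x i)

def uniformInnerWidth (δ : ℝ) (θ : Θ) : ℝ :=
  uniformBernsteinWidth 𝒮.R (δ / 3) fun i => 𝒮.weight θ (x i)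

/-- On the sample `x`, the intervals with outer half-widths `ε` and inner half-widths `ξ` are
valid simultaneously for all parameters in `F`, and maximizing `Yhat` over `F` is justified. -/
structure UniformlyValid (F : Set Θ) (ε ξ : Θ → ℝ) : Prop where
  outer : ∀ θ ∈ F, 𝒮.Yhat x θ - ε θ ≤ 𝒮.Ybar θ ∧ 𝒮.Ybar θ ≤ 𝒮.Yhat x θ + ε θ
  inner : ∀ θ ∈ F, 𝒮.Ybar θ ≤ 𝒮.Y θ ∧ 𝒮.Y θ ≤ 𝒮.Ybar θ + 𝒮.M * (1 - 𝒮.What x θ + ξ θ)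
  interval : ∀ θ ∈ F, 𝒮.Yhat x θ - ε θ ≤ 𝒮.Y θ ∧
    𝒮.Y θ ≤ 𝒮.Yhat x θ + 𝒮.M * (1 - 𝒮.What x θ + ξ θ) + ε θ
  learning : ∀ θstar ∈ F, IsMaxOn (𝒮.Yhat x) F θstar →
    ∀ θ ∈ F, 𝒮.Ybar θ - ε θ - ε θstar ≤ 𝒮.Y θstar

variable (F : Set Θ)

/-- The functions `f_θ = ℓ w̄_θ`, for `θ ∈ F`. -/
def valueClass : Set (Ω → ℝ) := 𝒮.weightedValue '' F

/-- The functions `g_θ = w̄_θ`, for `θ ∈ F`. -/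
def weightClass : Set (Ω → ℝ) := 𝒮.weight '' F

/-- `𝓜(n) = 10 𝒩(2n, r)` for the class of all `f_θ` and `g_θ`, at resolution `r`. -/
def capacity (n : ℕ) (r : ℝ≥0) : ℕ∞ :=
  10 * growthFunction (2 * n) r (𝒮.valueClass F ∪ 𝒮.weightClass F)

end Setup

end Counterfactual

end

/-! Both weight rules satisfy 0 ≤ p w̄ ≤ q. Hence Y - Ybar = ∫ ℓ (q - p w̄) dν lies between 0 and M
(1 - ∫ w̄ dP), and validity reduces to three one-sided deviation bounds: both sides for ℓ w̄, and
one side for w̄, whose sample mean must not overshoot (`uniformlyValid_of_le`). Each is used at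
failure probability δ / 3.

For a finite family the bound is the empirical Bernstein inequality with a union bound over
parameters. Bernstein's inequality involves the true variance, which is then replaced by the sample
variance through a lower tail bound for the latter. That tail rests on Hoeffding's averaging device:
the sample variance is an average over permutations of means of (x - y)² / 2 over disjoint pairs.
Each such mean is built from independent terms, and Jensen's inequality carries its exponential
moment bound over to the average (`mgf_neg_sampleVariance_le`). Identical distribution is not
required, so the same tail serves for random swaps.

For an arbitrary family the argument is symmetrization. If some function deviates on a sample, then
a second, ghost sample completes it with probability at least 1/5 to a double sample whose trace
meets `deviationSet` (`one_fifth_le_measure_pi_deviationSet`). The law of the double sample is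
invariant under exchanging i-th entries of its halves, so it suffices to bound the probability under
random swaps of a fixed double sample. There a finite cover of the trace replaces the class. For
each centre, Hoeffding's inequality bounds the difference of the half sums through the
swap-invariant quantity T = `halfDistSq`, and the variance tail bounds T through the spread of the
first half. Both bounds together exclude the deviation set (`notMem_deviationSet`). Two failure
events per centre and the factor 5 from the ghost sample give the factor 10. -/

noncomputable section

namespace Counterfactual

/-! ### Sample statistics -/

section Statistics

variable {n : ℕ}

theorem mul_sampleMean (u : Fin n → ℝ) : n * sampleMean u = ∑ i, u i := by
  rcases eq_or_ne n 0 with rfl | hn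
  · simp
  · unfold sampleMean; field_simp

theorem sum_sub_sampleMean_sq (u : Fin n → ℝ) :
    ∑ i, (u i - sampleMean u) ^ 2 = ∑ i, u i ^ 2 - n * sampleMean u ^ 2 := by
  have h := mul_sampleMean u
  simp only [sub_sq, Finset.sum_add_distrib, Finset.sum_sub_distrib, Finset.sum_const,
    Finset.card_univ, Fintype.card_fin, nsmul_eq_mul, ← Finset.sum_mul, ← Finset.mul_sum]
  rw [← h]; ring

theorem sampleMean_div (u : Fin n → ℝ) (b : ℝ) :
    sampleMean (fun i => u i / b) = sampleMean u / b := by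
  simp only [sampleMean, ← Finset.sum_div, div_right_comm]

theorem sampleVariance_div (u : Fin n → ℝ) (b : ℝ) :
    sampleVariance (fun i => u i / b) = sampleVariance u / b ^ 2 := by
  simp only [sampleVariance, sampleMean_div, ← sub_div, div_pow, ← Finset.sum_div, div_right_comm]

theorem sampleVariance_nonneg (hn : 1 ≤ n) (u : Fin n → ℝ) : 0 ≤ sampleVariance u := by
  have : (1 : ℝ) ≤ n := by exact_mod_cast hn
  exact div_nonneg (Finset.sum_nonneg fun _ _ => sq_nonneg _) (by linarith)

theorem sampleMean_mem_Icc (hn : 1 ≤ n) {u : Fin n → ℝ} {b : ℝ} (hu : ∀ i, u i ∈ Set.Icc 0 b) :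
    sampleMean u ∈ Set.Icc 0 b := by
  have hn' : (0 : ℝ) < n := by exact_mod_cast hn
  refine ⟨div_nonneg (Finset.sum_nonneg fun i _ => (hu i).1) hn'.le, ?_⟩
  rw [sampleMean, div_le_iff₀ hn']
  calc ∑ i, u i ≤ ∑ _i : Fin n, b := Finset.sum_le_sum fun i _ => (hu i).2
    _ = b * n := by simp [mul_comm]

/-- Since u² ≤ b u on [0, b], the sum is at most n m (b - m) with m the mean, and m (b - m) ≤ b² /
4. -/
theorem sum_sub_sampleMean_sq_le {u : Fin n → ℝ} {b : ℝ} (hu : ∀ i, u i ∈ Set.Icc 0 b) :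
    ∑ i, (u i - sampleMean u) ^ 2 ≤ n * (b ^ 2 / 4) := by
  rw [sum_sub_sampleMean_sq]
  have h : ∑ i, u i ^ 2 ≤ b * (n * sampleMean u) := by
    rw [mul_sampleMean, Finset.mul_sum]
    exact Finset.sum_le_sum fun i _ => by nlinarith [(hu i).1, (hu i).2]
  have hn : (0 : ℝ) ≤ n := n.cast_nonneg
  nlinarith [mul_nonneg hn (sq_nonneg (sampleMean u - b / 2))]

/-- The Euclidean norm of the centred sample. -/
def centeredNorm (u : Fin n → ℝ) : ℝ := √(∑ i, (u i - sampleMean u) ^ 2)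

theorem centeredNorm_nonneg (u : Fin n → ℝ) : 0 ≤ centeredNorm u := Real.sqrt_nonneg _

theorem centeredNorm_sq (u : Fin n → ℝ) :
    centeredNorm u ^ 2 = ∑ i, (u i - sampleMean u) ^ 2 :=
  Real.sq_sqrt (Finset.sum_nonneg fun _ _ => sq_nonneg _)

theorem sampleVariance_eq_centeredNorm_sq (u : Fin n → ℝ) :
    sampleVariance u = centeredNorm u ^ 2 / ((n : ℝ) - 1) := by
  rw [centeredNorm_sq, sampleVariance]

theorem sqrt_sum_add_sq_le (u v : Fin n → ℝ) :
    √(∑ i, (u i + v i) ^ 2) ≤ √(∑ i, u i ^ 2) + √(∑ i, v i ^ 2) := by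
  simpa [EuclideanSpace.norm_eq] using norm_add_le (WithLp.toLp 2 u) (WithLp.toLp 2 v)

/-- Centring is an orthogonal projection, so it does not increase Euclidean distances. -/
theorem centeredNorm_le_add (u v : Fin n → ℝ) :
    centeredNorm u ≤ centeredNorm v + √(∑ i, (u i - v i) ^ 2) := by
  have hm : sampleMean (fun i => u i - v i) = sampleMean u - sampleMean v := by
    simp [sampleMean, sub_div]
  have h := sqrt_sum_add_sq_le (fun i => v i - sampleMean v)
    (fun i => (u i - v i) - sampleMean (fun i => u i - v i))
  rw [sum_sub_sampleMean_sq (fun i => u i - v i)] at h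
  have h' : √(∑ i, (u i - v i) ^ 2 - n * sampleMean (fun i => u i - v i) ^ 2)
      ≤ √(∑ i, (u i - v i) ^ 2) :=
    Real.sqrt_le_sqrt (sub_le_self _ (mul_nonneg n.cast_nonneg (sq_nonneg _)))
  have e : centeredNorm u = √(∑ i, (v i - sampleMean v +
      ((u i - v i) - sampleMean (fun i => u i - v i))) ^ 2) := by
    rw [centeredNorm, hm]; congr 1; refine Finset.sum_congr rfl fun i _ => by ring
  rw [e]
  exact h.trans (add_le_add le_rfl h')

theorem continuous_sampleMean : Continuous (sampleMean : (Fin n → ℝ) → ℝ) := by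
  unfold sampleMean; fun_prop

theorem continuous_centeredNorm : Continuous (centeredNorm : (Fin n → ℝ) → ℝ) := by
  have := continuous_sampleMean (n := n)
  unfold centeredNorm; fun_prop

theorem continuous_sampleVariance : Continuous (sampleVariance : (Fin n → ℝ) → ℝ) := by
  have := continuous_sampleMean (n := n)
  unfold sampleVariance; fun_prop

/-- A width of Bernstein form is of order `b * L / √n`. -/
theorem sqrt_add_mul_div_le {k : ℕ} (hk : 2 ≤ k) (hkn : k ≤ n) {u : Fin n → ℝ} {a b c L : ℝ}
    (hu : ∀ i, u i ∈ Set.Icc 0 b) (hb : 0 ≤ b) (hL : 1 ≤ L) (ha : 0 ≤ a) (hc : 0 ≤ c)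
    (h : √(a * k / (4 * (k - 1))) + c * √k / (k - 1) ≤ 7) :
    √(a * sampleVariance u * L / n) + b * (c * L / ((n : ℝ) - 1)) ≤ 7 * b * L / √n := by
  have hk1 : (1 : ℝ) < k := by exact_mod_cast (by omega : 1 < k)
  have hkn' : (k : ℝ) ≤ n := by exact_mod_cast hkn
  have hn1 : (1 : ℝ) < n := hk1.trans_le hkn'
  have hsn : 0 < √(n : ℝ) := Real.sqrt_pos.2 (by linarith)
  have hsk : 0 < √(k : ℝ) := Real.sqrt_pos.2 (by linarith)
  -- Both n / (n - 1) and √n / (n - 1) decrease in n, so the smallest admissible sample size k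
  -- decides the constant.
  have hratio : (n : ℝ) / (n - 1) ≤ k / (k - 1) := by
    rw [div_le_div_iff₀ (by linarith) (by linarith)]; nlinarith
  have hV : sampleVariance u ≤ b ^ 2 * (k / (4 * (k - 1))) := by
    calc sampleVariance u ≤ n * (b ^ 2 / 4) / (n - 1) :=
          div_le_div_of_nonneg_right (sum_sub_sampleMean_sq_le hu) (by linarith)
      _ = b ^ 2 / 4 * (n / (n - 1)) := by ring
      _ ≤ b ^ 2 / 4 * (k / (k - 1)) := by gcongr
      _ = _ := by rw [mul_comm (4 : ℝ), ← div_div]; ring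
  have h1 : √(a * sampleVariance u * L / n) ≤ b * L / √n * √(a * k / (4 * (k - 1))) := by
    have hpos : 0 ≤ a * (b ^ 2 * (k / (4 * (k - 1)))) := by
      have : 0 < (k : ℝ) - 1 := by linarith
      positivity
    calc √(a * sampleVariance u * L / n)
        ≤ √(a * (b ^ 2 * (k / (4 * (k - 1)))) * L ^ 2 / n) := by
          apply Real.sqrt_le_sqrt
          have : L ≤ L ^ 2 := by nlinarith
          gcongr
      _ = √((b * L / √n) ^ 2 * (a * k / (4 * (k - 1)))) := by
          congr 1
          rw [div_pow, Real.sq_sqrt (by linarith)]; ring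
      _ = _ := by
          rw [Real.sqrt_mul (sq_nonneg _), Real.sqrt_sq (by positivity)]
  have h2 : b * (c * L / ((n : ℝ) - 1)) ≤ b * L / √n * (c * √k / (k - 1)) := by
    have e : √(n : ℝ) / (n - 1) ≤ √k / (k - 1) := by
      have e1 : √(n : ℝ) / (n - 1) = n / (n - 1) / √n := by
        rw [div_div, mul_comm, ← div_div, Real.div_sqrt]
      have e2 : √(k : ℝ) / (k - 1) = k / (k - 1) / √k := by
        rw [div_div, mul_comm, ← div_div, Real.div_sqrt]
      rw [e1, e2]
      have : 0 < (k : ℝ) - 1 := by linarith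
      gcongr
    calc b * (c * L / ((n : ℝ) - 1)) = b * L / √n * (c * (√n / (n - 1))) := by
          field_simp
      _ ≤ b * L / √n * (c * (√k / (k - 1))) := by gcongr
      _ = _ := by ring
  calc _ ≤ b * L / √n * (√(a * k / (4 * (k - 1))) + c * √k / (k - 1)) := by
        rw [mul_add]; exact add_le_add h1 h2
    _ ≤ b * L / √n * 7 := by gcongr
    _ = _ := by ring

theorem bernsteinWidth_le (hn : 2 ≤ n) {u : Fin n → ℝ} {b δ : ℝ} (hb : 0 ≤ b)
    (hu : ∀ i, u i ∈ Set.Icc 0 b) (hL : 1 ≤ Real.log (2 / δ)) :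
    bernsteinWidth b δ u ≤ 7 * b * Real.log (2 / δ) / √n := by
  have h := sqrt_add_mul_div_le (k := 2) (a := 2) (c := 7 / 3) le_rfl hn hu hb hL
    (by norm_num) (by norm_num) (by
      have : √(2 : ℝ) ≤ 3 / 2 := Real.sqrt_le_iff.2 (by norm_num)
      norm_num
      linarith)
  refine le_of_eq_of_le ?_ h
  rw [bernsteinWidth]
  congr 2
  rw [mul_comm (3 : ℝ), ← div_div]; ring

theorem uniformBernsteinWidth_le (hn : 16 ≤ n) {u : Fin n → ℝ} {b δ : ℝ} (hb : 0 ≤ b)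
    (hu : ∀ i, u i ∈ Set.Icc 0 b) (hL : 1 ≤ Real.log (1 / δ)) :
    uniformBernsteinWidth b δ u ≤ 7 * b * Real.log (1 / δ) / √n := by
  refine sqrt_add_mul_div_le (k := 16) (a := 18) (c := 15) (by norm_num) hn hu hb hL
    (by norm_num) (by norm_num) ?_
  -- At k = 16 the linear term is 15 · 4 / 15 = 4, and the root contributes at most 3.
  have h16 : √(16 : ℝ) = 4 := by
    rw [show (16 : ℝ) = 4 ^ 2 by norm_num]; exact Real.sqrt_sq (by norm_num)
  have : √(18 * 16 / (4 * (16 - 1)) : ℝ) ≤ 3 := Real.sqrt_le_iff.2 (by norm_num)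
  push_cast
  rw [h16]
  linarith

end Statistics

/-! ### The sample variance as an average over pairings -/

section Pairings

variable {n : ℕ}

/-- The index `2 k`, the first of the `k`-th pair of a sample. -/
def pairFst (k : Fin (n / 2)) : Fin n := ⟨2 * k, by omega⟩

/-- The index `2 k + 1`, the second of the `k`-th pair of a sample. -/
def pairSnd (k : Fin (n / 2)) : Fin n := ⟨2 * k + 1, by omega⟩

theorem pairFst_ne_pairSnd (k : Fin (n / 2)) : pairFst k ≠ pairSnd k := by
  simp [pairFst, pairSnd]

/-- All indices that occur in the pairs. -/
def pairIndex (p : Fin (n / 2) × Bool) : Fin n := bif p.2 then pairFst p.1 else pairSnd p.1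

theorem pairIndex_injective : Function.Injective (pairIndex (n := n)) := by
  rintro ⟨a, b⟩ ⟨c, d⟩ hab
  have h2 := congrArg Fin.val hab
  cases b <;> cases d <;>
    simp [pairIndex, pairFst, pairSnd, Prod.ext_iff, Fin.ext_iff] at h2 ⊢ <;> omega

/-- At most one index is left out of the pairs. -/
theorem sum_le_sum_pairs_add_one {h : Fin n → ℝ} (h1 : ∀ i, h i ≤ 1) :
    ∑ i, h i ≤ ∑ k, (h (pairFst k) + h (pairSnd k)) + 1 := by
  classical
  have e1 : ∑ k, (h (pairFst k) + h (pairSnd k))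
      = ∑ i ∈ Finset.univ.image (pairIndex (n := n)), h i := by
    rw [Finset.sum_image pairIndex_injective.injOn, Fintype.sum_prod_type]
    simp [pairIndex]
  have e2 : (∑ i ∈ (Finset.univ.image (pairIndex (n := n)))ᶜ, h i) ≤ 1 := by
    calc (∑ i ∈ (Finset.univ.image (pairIndex (n := n)))ᶜ, h i)
        ≤ ∑ i ∈ (Finset.univ.image (pairIndex (n := n)))ᶜ, (1 : ℝ) :=
          Finset.sum_le_sum fun i _ => h1 i
      _ ≤ 1 := by
          rw [Finset.sum_const, Finset.card_compl, Finset.card_image_of_injective _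
            pairIndex_injective]
          simp only [Finset.card_univ, Fintype.card_prod, Fintype.card_fin, Fintype.card_bool,
            nsmul_eq_mul, mul_one]
          exact_mod_cast (by omega : n - n / 2 * 2 ≤ 1)
  rw [e1, ← Finset.sum_add_sum_compl (Finset.univ.image (pairIndex (n := n)))]
  linarith

/-- The halved square differences over the pairs of the permuted sample, added up. -/
def pairingSum (π : Equiv.Perm (Fin n)) (u : Fin n → ℝ) : ℝ :=
  ∑ k, (u (π (pairFst k)) - u (π (pairSnd k))) ^ 2 / 2

theorem exists_perm_map_pair {α : Type*} [DecidableEq α] {i j k l : α} (hij : i ≠ j)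
    (hkl : k ≠ l) : ∃ τ : Equiv.Perm α, τ i = k ∧ τ j = l := by
  refine ⟨(Equiv.swap i k).trans (Equiv.swap (Equiv.swap i k j) l), ?_, ?_⟩
  · rw [Equiv.trans_apply, Equiv.swap_apply_left, Equiv.swap_apply_of_ne_of_ne _ hkl]
    intro h
    have : Equiv.swap i k i = Equiv.swap i k j := by rw [Equiv.swap_apply_left]; exact h
    exact hij ((Equiv.swap i k).injective this)
  · simp

/-- The symmetric group is doubly transitive, and right translation permutes the summands. -/
theorem sum_perm_pair_eq {α : Type*} [Fintype α] [DecidableEq α] (g : α → α → ℝ) {i j k l : α}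
    (hij : i ≠ j) (hkl : k ≠ l) :
    ∑ π : Equiv.Perm α, g (π i) (π j) = ∑ π : Equiv.Perm α, g (π k) (π l) := by
  obtain ⟨τ, rfl, rfl⟩ := exists_perm_map_pair hij hkl
  exact (Fintype.sum_equiv (Equiv.mulRight τ) _ _ fun π => rfl).symm

/-- All off-diagonal pairs give the same sum over permutations; adding up over all pairs before or
after the permutations gives both sides. -/
theorem sum_perm_pair {α : Type*} [Fintype α] [DecidableEq α] (g : α → α → ℝ)
    (hg : ∀ a, g a a = 0) {i j : α} (hij : i ≠ j) :
    (Fintype.card α * (Fintype.card α - 1) : ℝ) * ∑ π : Equiv.Perm α, g (π i) (π j)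
      = Fintype.card (Equiv.Perm α) * ∑ a, ∑ b, g a b := by
  obtain ⟨s, hs⟩ : ∃ s, ∑ π : Equiv.Perm α, g (π i) (π j) = s := ⟨_, rfl⟩
  rw [hs]
  have h1 : ∀ a b, ∑ π : Equiv.Perm α, g (π a) (π b) = if a = b then 0 else s := by
    intro a b
    split_ifs with h
    · simp [h, hg]
    · rw [← hs]; exact sum_perm_pair_eq g h hij
  have h2 : ∑ a, ∑ b, ∑ π : Equiv.Perm α, g (π a) (π b)
      = Fintype.card (Equiv.Perm α) * ∑ a, ∑ b, g a b := by
    calc _ = ∑ a, ∑ π : Equiv.Perm α, ∑ b, g (π a) (π b) :=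
          Finset.sum_congr rfl fun a _ => Finset.sum_comm
      _ = ∑ π : Equiv.Perm α, ∑ a, ∑ b, g (π a) (π b) := Finset.sum_comm
      _ = ∑ π : Equiv.Perm α, ∑ a, ∑ b, g a b := by
          refine Finset.sum_congr rfl fun π _ => ?_
          rw [Equiv.sum_comp π (fun a => ∑ b, g a (π b))]
          exact Finset.sum_congr rfl fun a _ => Equiv.sum_comp π (g a)
      _ = _ := by simp
  rw [← h2]
  simp_rw [h1]
  have h3 : ∀ a : α, ∑ b, (if a = b then 0 else s) = (Fintype.card α - 1) * s := by
    intro a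
    have : ∀ b, (if a = b then 0 else s) = s - if a = b then s else 0 := by
      intro b; split_ifs <;> simp
    simp_rw [this, Finset.sum_sub_distrib]
    simp [sub_mul]
  simp_rw [h3]
  simp [mul_assoc]

theorem sum_sum_sub_sq (u : Fin n → ℝ) :
    ∑ i, ∑ j, (u i - u j) ^ 2 = 2 * n * ∑ i, (u i - sampleMean u) ^ 2 := by
  have h := mul_sampleMean u
  rw [sum_sub_sampleMean_sq]
  simp only [sub_sq, Finset.sum_add_distrib, Finset.sum_sub_distrib, Finset.sum_const,
    Finset.card_univ, Fintype.card_fin, nsmul_eq_mul, ← Finset.sum_mul, ← Finset.mul_sum]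
  rw [← h]; ring

/-- The sample variance is the average over all permutations of the mean over pairs. -/
theorem sum_perm_pairingSum (hn : 2 ≤ n) (u : Fin n → ℝ) :
    ∑ π : Equiv.Perm (Fin n), pairingSum π u
      = Fintype.card (Equiv.Perm (Fin n)) * ((n / 2 : ℕ) * sampleVariance u) := by
  have hn1 : (1 : ℝ) < n := by exact_mod_cast hn
  have key : ∀ k : Fin (n / 2), ∑ π : Equiv.Perm (Fin n),
      (u (π (pairFst k)) - u (π (pairSnd k))) ^ 2 / 2
        = Fintype.card (Equiv.Perm (Fin n)) * sampleVariance u := by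
    intro k
    have h := sum_perm_pair (fun a b => (u a - u b) ^ 2 / 2) (by simp) (pairFst_ne_pairSnd k)
    have h2 : ∑ a, ∑ b, (u a - u b) ^ 2 / 2 = n * ∑ i, (u i - sampleMean u) ^ 2 := by
      simp_rw [← Finset.sum_div]
      rw [sum_sum_sub_sq]; ring
    simp only [Fintype.card_fin] at h
    rw [h2] at h
    have hne : (n * (n - 1) : ℝ) ≠ 0 := (mul_pos (by linarith) (by linarith)).ne'
    apply mul_left_cancel₀ hne
    have hn2 : (n : ℝ) - 1 ≠ 0 := by linarith
    rw [h, sampleVariance]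
    field_simp
  unfold pairingSum
  rw [Finset.sum_comm]
  simp_rw [key]
  simp; ring

end Pairings

/-! ### Independence of blocks -/

section Blocks

variable {S : Type*} [MeasurableSpace S] {μ : Measure S}

/-- Independence says that the joint law is a product, and a product over a sigma type is a product
of products, one factor per block. -/
theorem iIndepFun_curry {ι : Type*} {κ : ι → Type*} {𝓧 : (i : ι) → κ i → Type*}
    {_ : ∀ i j, MeasurableSpace (𝓧 i j)} {X : (i : ι) → (j : κ i) → S → 𝓧 i j}
    (mX : ∀ i j, Measurable (X i j))
    (h : iIndepFun (fun (p : (i : ι) × κ i) ω => X p.1 p.2 ω) μ) :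
    iIndepFun (fun i ω j => X i j ω) μ := by
  have := h.isProbabilityMeasure
  have : ∀ i j, IsProbabilityMeasure (μ.map (X i j)) :=
    fun i j => Measure.isProbabilityMeasure_map (mX i j).aemeasurable
  have hi : ∀ i, iIndepFun (X i) μ := fun i =>
    h.precomp (g := fun j : κ i => (⟨i, j⟩ : (i : ι) × κ i)) fun a b hab => by simpa using hab
  have hcurry : (MeasurableEquiv.piCurry 𝓧) ∘ (fun ω p => X p.1 p.2 ω) = fun ω i j => X i j ω := by
    ext; simp [Sigma.curry]
  rw [iIndepFun_iff_map_fun_eq_infinitePi_map (by fun_prop), ← hcurry,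
    ← Measure.map_map (by fun_prop) (by fun_prop),
    (iIndepFun_iff_map_fun_eq_infinitePi_map (by fun_prop)).1 h,
    Measure.infinitePi_map_piCurry (fun i j => μ.map (X i j))]
  congr 1
  ext1 i
  rw [(iIndepFun_iff_map_fun_eq_infinitePi_map (by fun_prop)).1 (hi i)]

theorem iIndepFun_pair {ι κ : Type*} {u : ι → S → ℝ} (hu : ∀ i, Measurable (u i))
    (h : iIndepFun u μ) {g : κ → Bool → ι} (hg : Function.Injective g.uncurry)
    {φ : ℝ → ℝ → ℝ} (hφ : Measurable φ.uncurry) :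
    iIndepFun (fun k ω => φ (u (g k true) ω) (u (g k false) ω)) μ := by
  have h1 : iIndepFun (fun (p : (_ : κ) × Bool) ω => u (g p.1 p.2) ω) μ := by
    refine h.precomp (g := fun p : (_ : κ) × Bool => g p.1 p.2) ?_
    rintro ⟨a, b⟩ ⟨c, d⟩ hab
    have := @hg (a, b) (c, d) hab
    simp_all
  have h2 := iIndepFun_curry (X := fun k b => u (g k b)) (fun k b => hu _) h1
  refine h2.comp (fun _ (y : Bool → ℝ) => φ (y true) (y false)) fun _ => ?_
  exact hφ.comp (f := fun y : Bool → ℝ => (y true, y false))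
    ((measurable_pi_apply true).prodMk (measurable_pi_apply false))

end Blocks

/-! ### Lower tail of the sample variance -/

section VarianceTail

variable {S : Type*} [MeasurableSpace S] {μ : Measure S} {n : ℕ}

theorem exp_neg_le_one_sub_add {x : ℝ} (hx : 0 ≤ x) : Real.exp (-x) ≤ 1 - x + x ^ 2 / 2 := by
  have hpos : 0 < 1 - x + x ^ 2 / 2 := by nlinarith [sq_nonneg (x - 1)]
  rw [Real.exp_neg, inv_le_comm₀ (Real.exp_pos _) hpos]
  refine le_trans ?_ (Real.quadratic_le_exp_of_nonneg hx)
  rw [inv_le_iff_one_le_mul₀ hpos]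
  -- (1 - x + x² / 2) (1 + x + x² / 2) = 1 + x⁴ / 4.
  nlinarith [sq_nonneg (x ^ 2)]

/-- The range [0, 1/2] turns the quadratic term into a linear one, as z² ≤ z / 2. The expectation of
z is then enough to bound the exponential moment. -/
theorem exp_neg_mul_le {l z : ℝ} (hl : 0 ≤ l) (hz : z ∈ Set.Icc 0 (1 / 2)) :
    Real.exp (-l * z) ≤ 1 - (l - l ^ 2 / 4) * z := by
  have h1 := exp_neg_le_one_sub_add (mul_nonneg hl hz.1)
  have h2 : (l * z) ^ 2 / 2 ≤ l ^ 2 / 4 * z := by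
    nlinarith [mul_nonneg (mul_nonneg (sq_nonneg l) hz.1) (sub_nonneg.2 hz.2)]
  rw [neg_mul]
  linarith

theorem measurable_pairingSum {u : Fin n → S → ℝ} (hu : ∀ i, Measurable (u i))
    (π : Equiv.Perm (Fin n)) : Measurable fun s => pairingSum π fun i => u i s := by
  unfold pairingSum; fun_prop

theorem pairingSum_nonneg (π : Equiv.Perm (Fin n)) (u : Fin n → ℝ) : 0 ≤ pairingSum π u :=
  Finset.sum_nonneg fun _ _ => by positivity

theorem integrable_exp_neg_mul [IsFiniteMeasure μ] {f : S → ℝ} (hf : Measurable f)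
    (h0 : ∀ s, 0 ≤ f s) {l : ℝ} (hl : 0 ≤ l) : Integrable (fun s => Real.exp (-l * f s)) μ := by
  refine Integrable.of_bound (C := 1) (by fun_prop) (ae_of_all _ fun s => ?_)
  rw [Real.norm_eq_abs, Real.abs_exp, Real.exp_le_one_iff]
  nlinarith [mul_nonneg hl (h0 s)]

theorem half_sub_sq_mem_Icc {x y : ℝ} (hx : x ∈ Set.Icc (0 : ℝ) 1) (hy : y ∈ Set.Icc (0 : ℝ) 1) :
    (x - y) ^ 2 / 2 ∈ Set.Icc (0 : ℝ) (1 / 2) := by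
  refine ⟨by positivity, ?_⟩
  nlinarith [hx.1, hx.2, hy.1, hy.2]

theorem mgf_neg_half_sub_sq_le [IsProbabilityMeasure μ] {X Y : S → ℝ} (hX : Measurable X)
    (hY : Measurable Y) (hX1 : ∀ s, X s ∈ Set.Icc (0 : ℝ) 1) (hY1 : ∀ s, Y s ∈ Set.Icc (0 : ℝ) 1)
    (h : IndepFun X Y μ) {l : ℝ} (hl : l ∈ Set.Icc (0 : ℝ) 4) :
    mgf (fun s => (X s - Y s) ^ 2 / 2) μ (-l)
      ≤ Real.exp (-(l - l ^ 2 / 4) * ((Var[X; μ] + Var[Y; μ]) / 2)) := by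
  have hZ1 := fun s => half_sub_sq_mem_Icc (hX1 s) (hY1 s)
  have hXL : MemLp X 2 μ := memLp_of_bounded (ae_of_all _ hX1) hX.aestronglyMeasurable 2
  have hYL : MemLp Y 2 μ := memLp_of_bounded (ae_of_all _ hY1) hY.aestronglyMeasurable 2
  have hZint : Integrable (fun s => (X s - Y s) ^ 2 / 2) μ :=
    Integrable.of_mem_Icc 0 (1 / 2) (by fun_prop) (ae_of_all _ hZ1)
  -- E (X - Y)² is at least Var (X - Y); the squared difference of the means is dropped, so the
  -- means may differ.
  have hvar : (Var[X; μ] + Var[Y; μ]) / 2 ≤ ∫ s, (X s - Y s) ^ 2 / 2 ∂μ := by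
    have h1 : Var[X - Y; μ] = Var[X; μ] + Var[Y; μ] := by
      rw [variance_sub hXL hYL, h.covariance_eq_zero hXL hYL]; ring
    have h2 := variance_le_expectation_sq (μ := μ) (X := X - Y)
      (hX.sub hY).aestronglyMeasurable
    rw [integral_div]
    have h3 : μ[(X - Y) ^ 2] = ∫ s, (X s - Y s) ^ 2 ∂μ := rfl
    linarith
  have hc : 0 ≤ l - l ^ 2 / 4 := by nlinarith [hl.1, hl.2]
  calc mgf (fun s => (X s - Y s) ^ 2 / 2) μ (-l)
      ≤ ∫ s, (1 - (l - l ^ 2 / 4) * ((X s - Y s) ^ 2 / 2)) ∂μ :=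
        integral_mono (integrable_exp_neg_mul (by fun_prop) (fun s => (hZ1 s).1) hl.1)
          ((integrable_const _).sub (hZint.const_mul _)) fun s => exp_neg_mul_le hl.1 (hZ1 s)
    _ = 1 - (l - l ^ 2 / 4) * ∫ s, (X s - Y s) ^ 2 / 2 ∂μ := by
        rw [integral_sub (integrable_const _) (hZint.const_mul _), integral_const_mul]
        simp
    _ ≤ 1 - (l - l ^ 2 / 4) * ((Var[X; μ] + Var[Y; μ]) / 2) := by gcongr
    _ ≤ _ := by
        have := Real.add_one_le_exp (-(l - l ^ 2 / 4) * ((Var[X; μ] + Var[Y; μ]) / 2))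
        linarith

/-- The pairs are disjoint, so the summands are independent and the moment generating function
factorizes. -/
theorem mgf_neg_pairingSum_le [IsProbabilityMeasure μ] {u : Fin n → S → ℝ}
    (hu : ∀ i, Measurable (u i)) (hu1 : ∀ i s, u i s ∈ Set.Icc (0 : ℝ) 1) (h : iIndepFun u μ)
    (π : Equiv.Perm (Fin n)) {l : ℝ} (hl : l ∈ Set.Icc (0 : ℝ) 4) :
    mgf (fun s => pairingSum π fun i => u i s) μ (-l)
      ≤ Real.exp (-(l - l ^ 2 / 4) *
        ∑ k, (Var[u (π (pairFst k)); μ] + Var[u (π (pairSnd k)); μ]) / 2) := by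
  have hind : iIndepFun (fun (k : Fin (n / 2)) s =>
      (u (π (pairFst k)) s - u (π (pairSnd k)) s) ^ 2 / 2) μ := by
    refine iIndepFun_pair (κ := Fin (n / 2)) hu h (g := fun k b => π (pairIndex (k, b)))
      (φ := fun x y => (x - y) ^ 2 / 2) ?_ ?_
    · exact π.injective.comp pairIndex_injective
    · simp only [Function.uncurry_def]; fun_prop
  have e : (fun s => pairingSum π fun i => u i s)
      = ∑ k, fun s => (u (π (pairFst k)) s - u (π (pairSnd k)) s) ^ 2 / 2 := by
    ext s; simp [pairingSum]
  rw [e, hind.mgf_sum (fun k => by fun_prop), Finset.mul_sum, Real.exp_sum]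
  refine Finset.prod_le_prod (fun _ _ => mgf_nonneg) fun k _ => ?_
  exact mgf_neg_half_sub_sq_le (hu _) (hu _) (hu1 _) (hu1 _)
    (h.indepFun fun hk => pairFst_ne_pairSnd k (π.injective hk)) hl

/-- The scaled sample variance is the uniform average of the dependent sums `pairingSum π`.
Convexity of exp bounds its exponential moment by the average of theirs. The number G must bound the
paired variances for every permutation because the variables need not have equal variances. -/
theorem mgf_neg_sampleVariance_le [IsProbabilityMeasure μ] (hn : 2 ≤ n) {u : Fin n → S → ℝ}
    (hu : ∀ i, Measurable (u i)) (hu1 : ∀ i s, u i s ∈ Set.Icc (0 : ℝ) 1) (h : iIndepFun u μ)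
    {G : ℝ} (hG : ∀ π : Equiv.Perm (Fin n),
      G ≤ ∑ k, (Var[u (π (pairFst k)); μ] + Var[u (π (pairSnd k)); μ]) / 2)
    {l : ℝ} (hl : l ∈ Set.Icc (0 : ℝ) 4) :
    mgf (fun s => (n / 2 : ℕ) * sampleVariance fun i => u i s) μ (-l)
      ≤ Real.exp (-(l - l ^ 2 / 4) * G) := by
  have hc : 0 ≤ l - l ^ 2 / 4 := by nlinarith [hl.1, hl.2]
  set c : ℝ := (Fintype.card (Equiv.Perm (Fin n)) : ℝ) with hcdef
  have hcpos : 0 < c := Nat.cast_pos.2 Fintype.card_pos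
  have hint : ∀ π : Equiv.Perm (Fin n),
      Integrable (fun s => Real.exp (-l * pairingSum π fun i => u i s)) μ := fun π =>
    integrable_exp_neg_mul (measurable_pairingSum hu π) (fun s => pairingSum_nonneg _ _) hl.1
  have hvarm : Measurable fun s => sampleVariance fun i => u i s :=
    continuous_sampleVariance.measurable.comp (measurable_pi_lambda _ hu)
  calc mgf (fun s => (n / 2 : ℕ) * sampleVariance fun i => u i s) μ (-l)
      ≤ ∫ s, ∑ π : Equiv.Perm (Fin n), c⁻¹ * Real.exp (-l * pairingSum π fun i => u i s) ∂μ := by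
        refine integral_mono (integrable_exp_neg_mul (by fun_prop) (fun s =>
          mul_nonneg (Nat.cast_nonneg _) (sampleVariance_nonneg (by omega) _)) hl.1)
          (integrable_finsetSum _ fun π _ => (hint π).const_mul _) fun s => ?_
        have hj := convexOn_exp.map_sum_le (t := (Finset.univ : Finset (Equiv.Perm (Fin n))))
          (w := fun _ => c⁻¹) (p := fun π => -l * pairingSum π fun i => u i s)
          (fun _ _ => by positivity)
          (by
            rw [Finset.sum_const, Finset.card_univ, nsmul_eq_mul]
            exact mul_inv_cancel₀ hcpos.ne')
          (fun _ _ => Set.mem_univ _)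
        simp only [smul_eq_mul] at hj
        refine le_of_eq_of_le ?_ hj
        simp only
        rw [← Finset.mul_sum, ← Finset.mul_sum, sum_perm_pairingSum hn, ← hcdef]
        congr 1
        field_simp
    _ = ∑ π : Equiv.Perm (Fin n), c⁻¹ * mgf (fun s => pairingSum π fun i => u i s) μ (-l) := by
        rw [integral_finsetSum _ fun π _ => (hint π).const_mul _]
        simp_rw [integral_const_mul, mgf]
    _ ≤ ∑ _π : Equiv.Perm (Fin n), c⁻¹ * Real.exp (-(l - l ^ 2 / 4) * G) := by
        gcongr with π _
        refine (mgf_neg_pairingSum_le hu hu1 h π hl).trans (Real.exp_le_exp.2 ?_)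
        nlinarith [mul_le_mul_of_nonneg_left (hG π) hc]
    _ = _ := by
        rw [Finset.sum_const, Finset.card_univ, nsmul_eq_mul, ← mul_assoc,
          mul_inv_cancel₀ hcpos.ne', one_mul]

/-- Lower tail of the sample variance of independent variables with values in `[0, 1]`. -/
theorem measure_sqrt_sampleVariance_lt_le [IsProbabilityMeasure μ] (hn : 2 ≤ n)
    {u : Fin n → S → ℝ} (hu : ∀ i, Measurable (u i))
    (hu1 : ∀ i s, u i s ∈ Set.Icc (0 : ℝ) 1) (h : iIndepFun u μ)
    {G : ℝ} (hG : ∀ π : Equiv.Perm (Fin n),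
      G ≤ ∑ k, (Var[u (π (pairFst k)); μ] + Var[u (π (pairSnd k)); μ]) / 2)
    {t : ℝ} (ht : 0 ≤ t) :
    μ.real {s | √((n / 2 : ℕ) * sampleVariance fun i => u i s) + √t < √G} ≤ Real.exp (-t) := by
  by_cases hGt : √G ≤ √t
  · have : {s | √((n / 2 : ℕ) * sampleVariance fun i => u i s) + √t < √G} = ∅ := by
      ext s
      simp only [Set.mem_ofPred_eq, Set.mem_empty_iff_false, iff_false, not_lt]
      exact hGt.trans (le_add_of_nonneg_left (Real.sqrt_nonneg _))
    rw [this]; simpa using (Real.exp_pos _).le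
  push Not at hGt
  have hG0 : 0 < G := by
    by_contra hcon
    rw [Real.sqrt_eq_zero_of_nonpos (not_lt.1 hcon)] at hGt
    exact absurd hGt (not_lt.2 (Real.sqrt_nonneg _))
  have hsG : √G ^ 2 = G := Real.sq_sqrt hG0.le
  have hst : √t ^ 2 = t := Real.sq_sqrt ht
  have hsG0 : 0 < √G := Real.sqrt_pos.2 hG0
  have hst0 : 0 ≤ √t := Real.sqrt_nonneg _
  -- This Chernoff parameter makes l √G = 2 √t and l² G = 4 t. The exponent becomes l t - 3 t, which
  -- is at most -t because √t < √G forces l ≤ 2.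
  set l : ℝ := 2 * √t / √G with hldef
  have hl : l ∈ Set.Icc (0 : ℝ) 4 := by
    refine ⟨by positivity, ?_⟩
    rw [hldef, div_le_iff₀ hsG0]; linarith
  have hV : ∀ s, 0 ≤ ((n / 2 : ℕ) : ℝ) * sampleVariance fun i => u i s := fun s =>
    mul_nonneg (Nat.cast_nonneg _) (sampleVariance_nonneg (by omega) _)
  have hvarm : Measurable fun s => sampleVariance fun i => u i s :=
    continuous_sampleVariance.measurable.comp (measurable_pi_lambda _ hu)
  calc μ.real {s | √((n / 2 : ℕ) * sampleVariance fun i => u i s) + √t < √G}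
      ≤ μ.real {s | (n / 2 : ℕ) * (sampleVariance fun i => u i s) ≤ (√G - √t) ^ 2} := by
        refine measureReal_mono fun s hs => ?_
        simp only [Set.mem_ofPred_eq] at hs ⊢
        rw [← Real.sq_sqrt (hV s)]
        have := Real.sqrt_nonneg ((n / 2 : ℕ) * sampleVariance fun i => u i s)
        gcongr
        linarith
    _ ≤ Real.exp (-(-l) * (√G - √t) ^ 2)
          * mgf (fun s => (n / 2 : ℕ) * sampleVariance fun i => u i s) μ (-l) :=
        measure_le_le_exp_mul_mgf _ (by linarith [hl.1])
          (integrable_exp_neg_mul (by fun_prop) hV hl.1)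
    _ ≤ Real.exp (-(-l) * (√G - √t) ^ 2) * Real.exp (-(l - l ^ 2 / 4) * G) := by
        gcongr
        exact mgf_neg_sampleVariance_le hn hu hu1 h hG hl
    _ ≤ Real.exp (-t) := by
        rw [← Real.exp_add, Real.exp_le_exp]
        have e1 : l * √G = 2 * √t := by rw [hldef]; field_simp
        have e2 : l ^ 2 * G = 4 * t := by
          rw [← hsG, ← mul_pow, e1, mul_pow, hst]; ring
        have e3 : l ≤ 2 := by rw [hldef, div_le_iff₀ hsG0]; linarith
        have e4 : l * t ≤ 2 * t := by gcongr
        have e5 : l * (√G - √t) ^ 2 = l * G - 4 * t + l * t := by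
          calc l * (√G - √t) ^ 2 = l * √G ^ 2 - 2 * (l * √G) * √t + l * √t ^ 2 := by ring
            _ = _ := by rw [e1, hsG, hst]; linear_combination -4 * hst
        linarith

end VarianceTail

/-! ### Bernstein's inequality -/

section Bernstein

variable {Ω : Type*} [MeasurableSpace Ω] {P : Measure Ω} [IsProbabilityMeasure P] {n : ℕ}

/-- The difference of the two sides and its derivative vanish at 0, and the second derivative is ((y
- 1) eʸ + 1) / 3 ≥ 0. -/
theorem one_sub_div_three_mul_exp_le {x : ℝ} (hx : 0 ≤ x) :
    (1 - x / 3) * (Real.exp x - 1 - x) ≤ x ^ 2 / 2 := by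
  have hd2 : ∀ y : ℝ, HasDerivAt (fun y => (y - 2) * Real.exp y + y + 2)
      ((y - 1) * Real.exp y + 1) y := fun y => by
    have := ((((hasDerivAt_id y).sub_const 2).mul (Real.hasDerivAt_exp y)).add
      (hasDerivAt_id y)).add_const 2
    exact this.congr_deriv (by simp only [id]; ring)
  have hd1 : ∀ y : ℝ, HasDerivAt (fun y => y ^ 2 / 2 - (1 - y / 3) * (Real.exp y - 1 - y))
      (((y - 2) * Real.exp y + y + 2) / 3) y := fun y => by
    have := (((hasDerivAt_id y).pow 2).div_const 2).sub
      ((((hasDerivAt_id y).div_const 3).const_sub 1).mul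
        (((Real.hasDerivAt_exp y).sub_const 1).sub (hasDerivAt_id y)))
    exact this.congr_deriv (by simp only [id]; norm_num; ring)
  have h2 : ∀ y : ℝ, 0 ≤ (y - 1) * Real.exp y + 1 := fun y => by
    have h := Real.add_one_le_exp (-y)
    have h' : Real.exp (-y) * Real.exp y = 1 := by rw [← Real.exp_add]; simp
    nlinarith [Real.exp_pos y]
  have hm2 : Monotone fun y : ℝ => (y - 2) * Real.exp y + y + 2 :=
    monotone_of_deriv_nonneg (fun y => (hd2 y).differentiableAt) fun y => by
      rw [(hd2 y).deriv]; exact h2 y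
  have hm1 : MonotoneOn (fun y : ℝ => y ^ 2 / 2 - (1 - y / 3) * (Real.exp y - 1 - y))
      (Set.Ici 0) := by
    refine monotoneOn_of_deriv_nonneg (convex_Ici 0)
      (fun y _ => (hd1 y).continuousAt.continuousWithinAt)
      (fun y _ => (hd1 y).differentiableAt.differentiableWithinAt) fun y hy => ?_
    rw [interior_Ici] at hy
    rw [(hd1 y).deriv]
    have := hm2 (le_of_lt hy : (0 : ℝ) ≤ y)
    simp at this
    linarith
  have := hm1 (Set.mem_Ici.2 le_rfl) (Set.mem_Ici.2 hx) hx
  simp at this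
  linarith

/-- The coefficient of y² is forced by positive y; for negative y already l² / 2 suffices. -/
theorem exp_mul_le_of_abs_le_one {l y : ℝ} (hl0 : 0 ≤ l) (hl3 : l < 3) (hy : |y| ≤ 1) :
    Real.exp (l * y) ≤ 1 + l * y + l ^ 2 / (2 * (1 - l / 3)) * y ^ 2 := by
  have hl : 0 < 1 - l / 3 := by linarith
  rcases le_total 0 y with h0 | h0
  · have hy1 : y ≤ 1 := (le_abs_self y).trans hy
    have hly : 0 ≤ l * y := mul_nonneg hl0 h0
    have h1 := one_sub_div_three_mul_exp_le hly
    have h2 : 0 ≤ Real.exp (l * y) - 1 - l * y := by linarith [Real.add_one_le_exp (l * y)]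
    have h3 : (1 - l / 3) * (Real.exp (l * y) - 1 - l * y) ≤ (l * y) ^ 2 / 2 := by
      refine le_trans ?_ h1
      gcongr
      nlinarith
    have h4 : Real.exp (l * y) - 1 - l * y ≤ (l * y) ^ 2 / 2 / (1 - l / 3) := by
      rw [le_div_iff₀ hl]; linarith
    have h5 : (l * y) ^ 2 / 2 / (1 - l / 3) = l ^ 2 / (2 * (1 - l / 3)) * y ^ 2 := by
      field_simp
    linarith
  · have h1 := exp_neg_le_one_sub_add (x := -(l * y)) (by nlinarith)
    rw [neg_neg] at h1
    have h2 : l ^ 2 / 2 ≤ l ^ 2 / (2 * (1 - l / 3)) := by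
      gcongr
      linarith
    nlinarith [mul_le_mul_of_nonneg_right h2 (sq_nonneg y)]

theorem mgf_le_of_abs_le_one {Y : Ω → ℝ} (hY : Measurable Y) (hY1 : ∀ ω, |Y ω| ≤ 1)
    (h0 : ∫ ω, Y ω ∂P = 0) {l : ℝ} (hl0 : 0 ≤ l) (hl3 : l < 3) :
    mgf Y P l ≤ Real.exp (l ^ 2 / (2 * (1 - l / 3)) * ∫ ω, Y ω ^ 2 ∂P) := by
  have hYi : Integrable Y P := Integrable.of_bound hY.aestronglyMeasurable 1 (ae_of_all _ hY1)
  have hY2i : Integrable (fun ω => Y ω ^ 2) P := by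
    refine Integrable.of_bound (by fun_prop) 1 (ae_of_all _ fun ω => ?_)
    rw [Real.norm_eq_abs, abs_pow]
    exact pow_le_one₀ (abs_nonneg _) (hY1 ω)
  have hei : Integrable (fun ω => Real.exp (l * Y ω)) P :=
    integrable_exp_mul_of_mem_Icc (a := -1) (b := 1) hY.aemeasurable
      (ae_of_all _ fun ω => abs_le.1 (hY1 ω))
  calc mgf Y P l ≤ ∫ ω, (1 + l * Y ω + l ^ 2 / (2 * (1 - l / 3)) * Y ω ^ 2) ∂P :=
        integral_mono hei (((integrable_const _).add (hYi.const_mul _)).add (hY2i.const_mul _))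
          fun ω => exp_mul_le_of_abs_le_one hl0 hl3 (hY1 ω)
    _ = 1 + l ^ 2 / (2 * (1 - l / 3)) * ∫ ω, Y ω ^ 2 ∂P := by
        rw [integral_add (f := fun ω => 1 + l * Y ω)
            ((integrable_const _).add (hYi.const_mul _)) (hY2i.const_mul _),
          integral_add (integrable_const _) (hYi.const_mul _), integral_const_mul,
          integral_const_mul, h0]
        simp
    _ ≤ _ := by rw [add_comm]; exact Real.add_one_le_exp _

theorem mgf_sum_pi {Y : Ω → ℝ} (hY : Measurable Y) (l : ℝ) :
    mgf (fun x : Fin n → Ω => ∑ i, Y (x i)) (Measure.pi fun _ => P) l = mgf Y P l ^ n := by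
  have h := (iIndepFun_pi (ι := Fin n) (μ := fun _ => P) (X := fun _ => Y)
    fun _ => hY.aemeasurable).mgf_sum (t := l) (fun i => by fun_prop) Finset.univ
  have e : (∑ i, fun x : Fin n → Ω => Y (x i)) = fun x : Fin n → Ω => ∑ i, Y (x i) := by
    ext; simp
  rw [e] at h
  rw [h]
  have h1 : ∀ i : Fin n, mgf (fun x : Fin n → Ω => Y (x i)) (Measure.pi fun _ => P) l
      = mgf Y P l := by
    intro i
    conv_rhs => rw [← (measurePreserving_eval (fun _ : Fin n => P) i).map_eq]
    unfold mgf
    rw [integral_map (measurable_pi_apply i).aemeasurable (by fun_prop)]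
  simp [h1]

theorem ae_pi_of_ae {p : Ω → Prop} (h : ∀ᵐ ω ∂P, p ω) :
    ∀ᵐ x : Fin n → Ω ∂(Measure.pi fun _ => P), ∀ i, p (x i) :=
  ae_all_iff.2 fun i =>
    (measurePreserving_eval (fun _ : Fin n => P) i).quasiMeasurePreserving.ae h

/-- **Bernstein's inequality** for centred variables with absolute value at most `1`. -/
theorem bernstein_inequality {Y : Ω → ℝ} (hY : Measurable Y) (hY1 : ∀ ω, |Y ω| ≤ 1)
    (h0 : ∫ ω, Y ω ∂P = 0) {t : ℝ} (ht : 0 < t) :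
    (Measure.pi fun _ => P).real {x : Fin n → Ω |
      √(2 * n * (∫ ω, Y ω ^ 2 ∂P) * t) + t / 3 < ∑ i, Y (x i)} ≤ Real.exp (-t) := by
  set v := ∫ ω, Y ω ^ 2 ∂P with hv
  have hv0 : 0 ≤ v := integral_nonneg fun ω => sq_nonneg _
  have hY2i : Integrable (fun ω => Y ω ^ 2) P := by
    refine Integrable.of_bound (by fun_prop) 1 (ae_of_all _ fun ω => ?_)
    rw [Real.norm_eq_abs, abs_pow]
    exact pow_le_one₀ (abs_nonneg _) (hY1 ω)
  -- Variance zero is separate: the parameter chosen below would become l = 3, where the moment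
  -- bound breaks down. The same holds for n = 0.
  rcases hv0.eq_or_lt with hv0 | hvpos
  · have hY0 : ∀ᵐ ω ∂P, Y ω = 0 := by
      filter_upwards [(integral_eq_zero_iff_of_nonneg (fun ω => sq_nonneg _) hY2i).1 hv0.symm]
        with ω hω using by simpa using hω
    have hz : (Measure.pi fun _ => P).real {x : Fin n → Ω |
        √(2 * n * v * t) + t / 3 < ∑ i, Y (x i)} = 0 := by
      rw [measureReal_eq_zero_iff]
      refine measure_mono_null (fun x hx => ?_) (ae_iff.1 (ae_pi_of_ae (n := n) hY0))
      intro hall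
      simp only [Set.mem_ofPred_eq, ← hv0, hall, Finset.sum_const_zero] at hx
      simp at hx
      linarith
    rw [hz]; positivity
  rcases n.eq_zero_or_pos with rfl | hn
  · have : {x : Fin 0 → Ω | √(2 * (0 : ℕ) * v * t) + t / 3 < ∑ i, Y (x i)} = ∅ := by
      ext x; simp; linarith
    rw [this]; simpa using (Real.exp_pos _).le
  have hn' : (0 : ℝ) < n := by exact_mod_cast hn
  -- With this w and l = 1 / (1/3 + w) one has 1 - l / 3 = l w, and the exponent -l (2 t w + t / 3)
  -- + l t w equals -t exactly.
  set w := √(n * v / (2 * t)) with hw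
  have hw0 : 0 < w := Real.sqrt_pos.2 (by positivity)
  have hw2 : n * v = 2 * t * w ^ 2 := by
    rw [hw, Real.sq_sqrt (by positivity)]; field_simp
  have hroot : √(2 * n * v * t) = 2 * t * w := by
    rw [show 2 * n * v * t = (2 * t * w) ^ 2 by rw [mul_assoc 2, hw2]; ring]
    exact Real.sqrt_sq (by positivity)
  set l := 1 / (1 / 3 + w) with hl
  have hl0 : 0 < l := by positivity
  have hlw : l * (1 / 3 + w) = 1 := by rw [hl]; field_simp
  have hl3 : l < 3 := by nlinarith
  have hl1 : 1 - l / 3 = l * w := by linarith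
  have hint : Integrable (fun x : Fin n → Ω => Real.exp (l * ∑ i, Y (x i)))
      (Measure.pi fun _ => P) := by
    refine integrable_exp_mul_of_mem_Icc (a := -n) (b := n)
      (Finset.measurable_sum _ fun i _ => hY.comp (measurable_pi_apply i)).aemeasurable
      (ae_of_all _ fun x => abs_le.1 ?_)
    calc |∑ i, Y (x i)| ≤ ∑ i, |Y (x i)| := Finset.abs_sum_le_sum_abs _ _
      _ ≤ ∑ _i : Fin n, (1 : ℝ) := Finset.sum_le_sum fun i _ => hY1 _
      _ = n := by simp
  calc (Measure.pi fun _ => P).real {x : Fin n → Ω | √(2 * n * v * t) + t / 3 < ∑ i, Y (x i)}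
      ≤ (Measure.pi fun _ => P).real {x : Fin n → Ω | 2 * t * w + t / 3 ≤ ∑ i, Y (x i)} := by
        rw [hroot]
        refine measureReal_mono fun x hx => ?_
        simp only [Set.mem_ofPred_eq] at hx ⊢
        exact hx.le
    _ ≤ Real.exp (-l * (2 * t * w + t / 3)) * mgf Y P l ^ n := by
        rw [← mgf_sum_pi hY]
        exact measure_ge_le_exp_mul_mgf _ hl0.le hint
    _ ≤ Real.exp (-l * (2 * t * w + t / 3)) * Real.exp (l ^ 2 / (2 * (1 - l / 3)) * v) ^ n := by
        gcongr
        · exact mgf_nonneg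
        · exact mgf_le_of_abs_le_one hY hY1 h0 hl0.le hl3
    _ = Real.exp (-t) := by
        rw [← Real.exp_nat_mul, ← Real.exp_add, hl1]
        congr 1
        have : (n : ℝ) * (l ^ 2 / (2 * (l * w)) * v) = l * t * w := by
          calc (n : ℝ) * (l ^ 2 / (2 * (l * w)) * v) = l ^ 2 / (2 * (l * w)) * (n * v) := by ring
            _ = l * t * w := by rw [hw2]; field_simp
        rw [this]
        linear_combination -t * hlw

end Bernstein

/-! ### The empirical Bernstein inequality -/

section EmpiricalBernstein

variable {Ω : Type*} [MeasurableSpace Ω] {P : Measure Ω} [IsProbabilityMeasure P] {n : ℕ}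

theorem sub_one_le_two_mul_half (n : ℕ) : (n : ℝ) - 1 ≤ 2 * (n / 2 : ℕ) := by
  have : n ≤ 2 * (n / 2) + 1 := by omega
  have : (n : ℝ) ≤ 2 * (n / 2 : ℕ) + 1 := by exact_mod_cast this
  linarith

/-- Lower tail of the sample standard deviation of a sample with values in `[0, 1]`. -/
theorem measure_pi_sqrt_sampleVariance_lt_le (hn : 2 ≤ n) {f : Ω → ℝ} (hf : Measurable f)
    (hf1 : ∀ ω, f ω ∈ Set.Icc (0 : ℝ) 1) {t : ℝ} (ht : 0 ≤ t) :
    (Measure.pi fun _ => P).real {x : Fin n → Ω |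
      √(sampleVariance fun i => f (x i)) + √(2 * t / ((n : ℝ) - 1)) < √Var[f; P]}
        ≤ Real.exp (-t) := by
  have hvar : ∀ i : Fin n, Var[fun x : Fin n → Ω => f (x i); Measure.pi fun _ => P] = Var[f; P] :=
    fun i => (measurePreserving_eval (fun _ : Fin n => P) i).variance_fun_comp hf.aemeasurable
  have h := measure_sqrt_sampleVariance_lt_le (μ := Measure.pi fun _ : Fin n => P) hn
    (u := fun i x => f (x i)) (fun i => by fun_prop) (fun i x => hf1 _)
    (iIndepFun_pi (μ := fun _ => P) (X := fun _ => f) fun _ => hf.aemeasurable)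
    (G := (n / 2 : ℕ) * Var[f; P]) (fun π => by simp [hvar]) ht
  refine (measureReal_mono fun x hx => ?_).trans h
  simp only [Set.mem_ofPred_eq] at hx ⊢
  have hn1 : (0 : ℝ) < n - 1 := by
    have : (2 : ℝ) ≤ n := by exact_mod_cast hn
    linarith
  have hm : (0 : ℝ) < (n / 2 : ℕ) := by exact_mod_cast (by omega : 0 < n / 2)
  rw [Real.sqrt_mul hm.le, Real.sqrt_mul hm.le]
  have h1 : √t ≤ √((n / 2 : ℕ) : ℝ) * √(2 * t / ((n : ℝ) - 1)) := by
    rw [← Real.sqrt_mul hm.le]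
    apply Real.sqrt_le_sqrt
    rw [← mul_div_assoc, le_div_iff₀ hn1]
    nlinarith [mul_le_mul_of_nonneg_left (sub_one_le_two_mul_half n) ht]
  nlinarith [mul_lt_mul_of_pos_left hx (Real.sqrt_pos.2 hm)]

theorem abs_integral_sub_le_one {f : Ω → ℝ} (hf : Measurable f)
    (hf1 : ∀ ω, f ω ∈ Set.Icc (0 : ℝ) 1) (ω : Ω) : |∫ ω', f ω' ∂P - f ω| ≤ 1 := by
  have hi : Integrable f P := Integrable.of_mem_Icc 0 1 hf.aemeasurable (ae_of_all _ hf1)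
  have h1 : 0 ≤ ∫ ω', f ω' ∂P := integral_nonneg fun ω => (hf1 ω).1
  have h2 : ∫ ω', f ω' ∂P ≤ 1 := by
    calc ∫ ω', f ω' ∂P ≤ ∫ _, (1 : ℝ) ∂P := integral_mono hi (integrable_const _) fun ω => (hf1 ω).2
      _ = 1 := by simp
  rw [abs_le]
  constructor <;> linarith [(hf1 ω).1, (hf1 ω).2]

/-- The **empirical Bernstein inequality**, for functions with values in `[0, 1]`. -/
theorem empirical_bernstein_unit (hn : 2 ≤ n) {f : Ω → ℝ} (hf : Measurable f)
    (hf1 : ∀ ω, f ω ∈ Set.Icc (0 : ℝ) 1) {s : ℝ} (hs : |s| = 1) {t : ℝ} (ht : 0 < t) :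
    (Measure.pi fun _ => P).real {x : Fin n → Ω |
      √(2 * (sampleVariance fun i => f (x i)) * t / n) + 7 * t / (3 * ((n : ℝ) - 1))
        < s * (∫ ω, f ω ∂P - sampleMean fun i => f (x i))} ≤ 2 * Real.exp (-t) := by
  have hs2 : s ^ 2 = 1 := by rw [← sq_abs, hs, one_pow]
  have hi : Integrable f P := Integrable.of_mem_Icc 0 1 hf.aemeasurable (ae_of_all _ hf1)
  set m := ∫ ω, f ω ∂P with hmdef
  have hn1 : (0 : ℝ) < n - 1 := by
    have : (2 : ℝ) ≤ n := by exact_mod_cast hn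
    linarith
  have hn0 : (0 : ℝ) < n := by linarith
  set Y : Ω → ℝ := fun ω => s * (m - f ω) with hYdef
  have hY : Measurable Y := by fun_prop
  have hY2 : ∫ ω, Y ω ^ 2 ∂P = Var[f; P] := by
    rw [variance_eq_integral hf.aemeasurable]
    refine integral_congr_ae (ae_of_all _ fun ω => ?_)
    simp only [hYdef, mul_pow, hs2, ← hmdef]
    ring
  have hY0 : ∫ ω, Y ω ∂P = 0 := by
    rw [integral_const_mul, integral_sub (integrable_const _) hi]
    simp [← hmdef]
  have hB := bernstein_inequality (P := P) (n := n) hY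
    (fun ω => by rw [abs_mul, hs, one_mul]; exact abs_integral_sub_le_one hf hf1 ω) hY0 ht
  have hV := measure_pi_sqrt_sampleVariance_lt_le (P := P) hn hf hf1 ht.le
  rw [hY2] at hB
  rw [two_mul]
  -- Outside two events of probability at most exp(-t) each, Bernstein's bound holds and the true
  -- standard deviation is at most the sample one plus √(2 t / (n - 1)).
  refine (measureReal_mono (fun x hx => ?_)).trans
    ((measureReal_union_le _ _).trans (add_le_add hB hV))
  by_contra hcon
  simp only [Set.mem_union, Set.mem_ofPred_eq, not_or, not_lt] at hcon hx
  obtain ⟨h1, h2⟩ := hcon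
  set V := sampleVariance fun i => f (x i)
  have hsum : ∑ i, Y (x i) = n * (s * (m - sampleMean fun i => f (x i))) := by
    simp only [hYdef, ← Finset.mul_sum, Finset.sum_sub_distrib, Finset.sum_const,
      Finset.card_univ, Fintype.card_fin, nsmul_eq_mul]
    rw [← mul_sampleMean fun i => f (x i)]
    ring
  rw [hsum] at h1
  have e1 : √(2 * n * Var[f; P] * t) = n * (√(2 * t / n) * √Var[f; P]) := by
    rw [← Real.sqrt_mul (by positivity), show 2 * n * Var[f; P] * t
      = (n : ℝ) ^ 2 * (2 * t / n * Var[f; P]) by field_simp, Real.sqrt_mul (by positivity),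
      Real.sqrt_sq hn0.le]
  have e2 : √(2 * t / n) * √V = √(2 * V * t / n) := by
    rw [← Real.sqrt_mul (by positivity)]; congr 1; ring
  have e3 : √(2 * t / n) * √(2 * t / ((n : ℝ) - 1)) ≤ 2 * t / (n - 1) := by
    rw [← Real.sqrt_mul (by positivity)]
    refine Real.sqrt_le_iff.2 ⟨by positivity, ?_⟩
    rw [sq]
    gcongr
    linarith
  have e4 : t / 3 ≤ n * (t / (3 * (n - 1))) := by
    rw [← mul_div_assoc, div_le_div_iff₀ (by norm_num) (by positivity)]
    nlinarith
  have h3 : n * (s * (m - sampleMean fun i => f (x i)))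
      ≤ n * (√(2 * V * t / n) + 2 * t / (n - 1) + t / (3 * (n - 1))) := by
    refine h1.trans ?_
    have := mul_le_mul_of_nonneg_left h2 (Real.sqrt_nonneg (2 * t / n))
    rw [e1, mul_add (n : ℝ)]
    refine add_le_add ?_ e4
    gcongr
    linarith
  have h4 := le_of_mul_le_mul_left h3 hn0
  -- The constant 7/3 is 2 from replacing the standard deviation plus 1/3 from Bernstein's linear
  -- term.
  have e5 : 2 * t / ((n : ℝ) - 1) + t / (3 * (n - 1)) = 7 * t / (3 * (n - 1)) := by
    field_simp; ring
  linarith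

/-- The **empirical Bernstein inequality** of Maurer and Pontil. -/
theorem empirical_bernstein (hn : 2 ≤ n) {f : Ω → ℝ} (hf : Measurable f) {b : ℝ} (hb : 0 < b)
    (hfb : ∀ ω, f ω ∈ Set.Icc 0 b) {s : ℝ} (hs : |s| = 1) {δ : ℝ} (hδ : 0 < δ) :
    (Measure.pi fun _ => P) {x : Fin n → Ω | bernsteinWidth b δ (fun i => f (x i))
        < s * (∫ ω, f ω ∂P - sampleMean fun i => f (x i))} ≤ ENNReal.ofReal δ := by
  rcases le_or_gt 1 δ with h1 | h1
  · exact prob_le_one.trans (ENNReal.one_le_ofReal.2 h1)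
  have ht : 0 < Real.log (2 / δ) := Real.log_pos (by rw [lt_div_iff₀ hδ]; linarith)
  have h := empirical_bernstein_unit (P := P) hn (f := fun ω => f ω / b) (by fun_prop)
    (fun ω => ⟨div_nonneg (hfb ω).1 hb.le, (div_le_one hb).2 (hfb ω).2⟩) hs ht
  rw [Real.exp_neg, Real.exp_log (by positivity), show 2 * (2 / δ)⁻¹ = δ by field_simp] at h
  rw [← ofReal_measureReal]
  refine ENNReal.ofReal_le_ofReal (le_of_eq_of_le ?_ h)
  congr 1
  ext x
  simp only [Set.mem_ofPred_eq, bernsteinWidth]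
  have hV : 0 ≤ sampleVariance fun i => f (x i) := sampleVariance_nonneg (by omega) _
  rw [sampleVariance_div (fun i => f (x i)), sampleMean_div (fun i => f (x i)), integral_div,
    show 2 * ((sampleVariance fun i => f (x i)) / b ^ 2) * Real.log (2 / δ) / n
      = 2 * (sampleVariance fun i => f (x i)) * Real.log (2 / δ) / n / b ^ 2 by ring,
    Real.sqrt_div' _ (sq_nonneg b), Real.sqrt_sq hb.le, ← sub_div,
    mul_div_assoc' s, lt_div_iff₀ hb, add_mul, div_mul_cancel₀ _ hb.ne', mul_comm b]

end EmpiricalBernstein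

/-! ### Random swaps of a double sample -/

section Swap

variable {n : ℕ} {α : Type*}

def firstHalf (z : Fin (2 * n) → α) (i : Fin n) : α := z (finProdFinEquiv (0, i))

def secondHalf (z : Fin (2 * n) → α) (i : Fin n) : α := z (finProdFinEquiv (1, i))

/-- The permutation of a double sample that exchanges the `i`-th entries of its halves whenever
`σ i` holds. -/
def swapPerm (σ : Fin n → Bool) : Equiv.Perm (Fin (2 * n)) :=
  finProdFinEquiv.permCongr (Equiv.prodCongrLeft fun i => bif σ i then Equiv.swap 0 1 else 1)

theorem firstHalf_swap (z : Fin (2 * n) → α) (σ : Fin n → Bool) (i : Fin n) :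
    firstHalf (z ∘ swapPerm σ) i = bif σ i then secondHalf z i else firstHalf z i := by
  cases h : σ i <;> simp [firstHalf, secondHalf, swapPerm, Equiv.permCongr_apply, h]

theorem secondHalf_swap (z : Fin (2 * n) → α) (σ : Fin n → Bool) (i : Fin n) :
    secondHalf (z ∘ swapPerm σ) i = bif σ i then firstHalf z i else secondHalf z i := by
  cases h : σ i <;> simp [firstHalf, secondHalf, swapPerm, Equiv.permCongr_apply, h]

/-- The law of a fair coin. -/
def coin : Measure Bool := (PMF.uniformOfFintype Bool).toMeasure

instance : IsProbabilityMeasure coin := by unfold coin; infer_instance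

theorem integral_coin (g : Bool → ℝ) : ∫ b, g b ∂coin = (g true + g false) / 2 := by
  rw [coin, PMF.integral_eq_sum]
  simp; ring

/-- The law of independent fair swaps. -/
def swapLaw (n : ℕ) : Measure (Fin n → Bool) := Measure.pi fun _ => coin

instance : IsProbabilityMeasure (swapLaw n) := by unfold swapLaw; infer_instance

/-- Sum of the squared distances between the entries of the two halves. -/
def halfDistSq (z : Fin (2 * n) → ℝ) : ℝ := ∑ i, (secondHalf z i - firstHalf z i) ^ 2

theorem halfDistSq_nonneg (z : Fin (2 * n) → ℝ) : 0 ≤ halfDistSq z :=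
  Finset.sum_nonneg fun _ _ => sq_nonneg _

theorem halfDistSq_swap (z : Fin (2 * n) → ℝ) (σ : Fin n → Bool) :
    halfDistSq (z ∘ swapPerm σ) = halfDistSq z := by
  refine Finset.sum_congr rfl fun i _ => ?_
  rw [firstHalf_swap, secondHalf_swap]
  cases σ i
  · rfl
  · simp only [cond_true]; ring

/-- Hoeffding's inequality for the difference of the halves under random swaps. -/
theorem swapLaw_sum_sub_le (z : Fin (2 * n) → ℝ) {s : ℝ} (hs : |s| = 1) {t : ℝ} (ht : 0 ≤ t) :
    (swapLaw n).real {σ | √(2 * halfDistSq z * t) <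
      s * ∑ i, (secondHalf (z ∘ swapPerm σ) i - firstHalf (z ∘ swapPerm σ) i)} ≤ Real.exp (-t) := by
  set d : Fin n → ℝ := fun i => secondHalf z i - firstHalf z i with hd
  set g : Fin n → Bool → ℝ := fun i b => s * (bif b then -d i else d i) with hg
  have hsum : ∀ σ, s * ∑ i, (secondHalf (z ∘ swapPerm σ) i - firstHalf (z ∘ swapPerm σ) i)
      = ∑ i, g i (σ i) := by
    intro σ
    rw [Finset.mul_sum]
    refine Finset.sum_congr rfl fun i _ => ?_
    rw [firstHalf_swap, secondHalf_swap]
    simp only [hg, hd]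
    cases σ i
    · rfl
    · simp only [cond_true]; ring
  have hgabs : ∀ i b, |g i b| = |d i| := by
    intro i b
    simp only [hg, abs_mul, hs, one_mul]
    cases b <;> simp
  -- For T = 0 the exponent of the subgaussian tail would read 0 / 0 = 0; the strict inequality
  -- makes the event empty instead.
  by_cases hT : halfDistSq z = 0
  · have hd0 : ∀ i, d i = 0 := fun i => by
      have := (Finset.sum_eq_zero_iff_of_nonneg fun i _ => sq_nonneg _).1 hT i (Finset.mem_univ _)
      simpa [hd] using this
    have : {σ | √(2 * halfDistSq z * t) <
        s * ∑ i, (secondHalf (z ∘ swapPerm σ) i - firstHalf (z ∘ swapPerm σ) i)} = ∅ := by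
      ext σ
      have h0 : ∀ i b, g i b = 0 := fun i b => by
        rw [← abs_eq_zero, hgabs, hd0, abs_zero]
      simp only [Set.mem_ofPred_eq, hsum, h0, Finset.sum_const_zero, hT]
      simp
    rw [this]; simpa using (Real.exp_pos _).le
  have hTpos : 0 < halfDistSq z := lt_of_le_of_ne (halfDistSq_nonneg z) (Ne.symm hT)
  have hsub : ∀ i, HasSubgaussianMGF (fun σ : Fin n → Bool => g i (σ i))
      ((‖|d i| - -|d i|‖₊ / 2) ^ 2) (swapLaw n) := by
    intro i
    refine hasSubgaussianMGF_of_mem_Icc_of_integral_eq_zero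
      ((measurable_of_finite (g i)).comp (measurable_pi_apply i)).aemeasurable
      (ae_of_all _ fun σ => abs_le.1 (hgabs i _).le) ?_
    rw [swapLaw, integral_comp_eval (μ := fun _ : Fin n => coin) (f := g i) (by fun_prop),
      integral_coin]
    simp [hg]
  have hc : ∀ i, (((‖|d i| - -|d i|‖₊ / 2) ^ 2 : ℝ≥0) : ℝ) = d i ^ 2 := by
    intro i
    push_cast
    rw [Real.norm_eq_abs, sub_neg_eq_add, ← two_mul, abs_mul, abs_abs]
    rw [← sq_abs (d i)]
    norm_num
  have hind : iIndepFun (fun i (σ : Fin n → Bool) => g i (σ i)) (swapLaw n) :=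
    iIndepFun_pi (μ := fun _ => coin) (X := g) fun i => by fun_prop
  have h := HasSubgaussianMGF.measure_sum_ge_le_of_iIndepFun hind (s := Finset.univ)
    (fun i _ => hsub i)
    (Real.sqrt_nonneg (2 * halfDistSq z * t))
  push_cast at h
  simp only [hsum]
  refine (measureReal_mono fun σ hσ => ?_).trans (h.trans (le_of_eq ?_))
  · simp only [Set.mem_ofPred_eq] at hσ ⊢
    exact hσ.le
  · have e : ∑ i, (‖|d i| - -|d i|‖ / 2) ^ 2 = halfDistSq z :=
      Finset.sum_congr rfl fun i _ => by
        have := hc i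
        push_cast at this
        exact this
    rw [e, Real.sq_sqrt (by positivity)]
    congr 1
    field_simp

/-- Lower tail of the sample variance of the first half under random swaps. -/
theorem swapLaw_sampleVariance_lt_le (hn : 2 ≤ n) {z : Fin (2 * n) → ℝ}
    (hz : ∀ j, z j ∈ Set.Icc (0 : ℝ) 1) {t : ℝ} (ht : 0 ≤ t) :
    (swapLaw n).real {σ | √((n / 2 : ℕ) * sampleVariance (firstHalf (z ∘ swapPerm σ))) + √t
      < √((halfDistSq z - 1) / 8)} ≤ Real.exp (-t) := by
  set g : Fin n → Bool → ℝ := fun i b => bif b then secondHalf z i else firstHalf z i with hg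
  have hgm : ∀ i b, g i b ∈ Set.Icc (0 : ℝ) 1 := fun i b => by cases b <;> exact hz _
  have hvar : ∀ i, Var[fun σ : Fin n → Bool => g i (σ i); swapLaw n]
      = (secondHalf z i - firstHalf z i) ^ 2 / 4 := by
    intro i
    rw [swapLaw, (measurePreserving_eval (fun _ : Fin n => coin) i).variance_fun_comp
      (f := g i) (by fun_prop), variance_eq_integral (by fun_prop), integral_coin, integral_coin]
    simp only [hg, cond_true, cond_false]
    ring
  have h := measure_sqrt_sampleVariance_lt_le (μ := swapLaw n) hn
    (u := fun i σ => g i (σ i)) (fun i => by fun_prop) (fun i σ => hgm _ _)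
    (iIndepFun_pi (μ := fun _ => coin) (X := g) fun i => by fun_prop)
    (G := (halfDistSq z - 1) / 8) (fun π => by
      simp only [hvar]
      -- Each swapped entry has variance d² / 4, so a pair contributes (d² + d'²) / 8. For odd n one
      -- index stays unpaired and costs at most 1, whence T - 1.
      have h1 := sum_le_sum_pairs_add_one
        (h := fun i => (secondHalf z (π i) - firstHalf z (π i)) ^ 2) fun i => by
          have h1 := hz (finProdFinEquiv (1, π i))
          have h2 := hz (finProdFinEquiv (0, π i))
          rw [sq_le_one_iff_abs_le_one, abs_le]
          simp only [firstHalf, secondHalf]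
          constructor <;> linarith [h1.1, h1.2, h2.1, h2.2]
      rw [Equiv.sum_comp π fun i => (secondHalf z i - firstHalf z i) ^ 2] at h1
      have e : ∀ a b : ℝ, (a / 4 + b / 4) / 2 = (a + b) / 8 := fun a b => by ring
      simp only [e, ← Finset.sum_div]
      have : halfDistSq z = ∑ i, (secondHalf z i - firstHalf z i) ^ 2 := rfl
      linarith) ht
  have e : ∀ σ, firstHalf (z ∘ swapPerm σ) = fun i => g i (σ i) := fun σ =>
    funext fun i => firstHalf_swap z σ i
  simpa only [e] using h

/-- The double samples whose second half is much more spread out than the first, or whose halves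
have sums that are far apart. -/
def deviationSet (n : ℕ) (s t : ℝ) : Set (Fin (2 * n) → ℝ) :=
  {z | 3.05 * centeredNorm (firstHalf z) + 2.83 * √t + 1.9 < centeredNorm (secondHalf z) ∨
    (2.91 * centeredNorm (firstHalf z) + 2) * √t + 4.1 * t + 2
      < s * ∑ i, (secondHalf z i - firstHalf z i)}

theorem isOpen_deviationSet (s t : ℝ) : IsOpen (deviationSet n s t) := by
  have h1 : Continuous fun z : Fin (2 * n) → ℝ => firstHalf z :=
    continuous_pi fun i => continuous_apply _
  have h2 : Continuous fun z : Fin (2 * n) → ℝ => secondHalf z :=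
    continuous_pi fun i => continuous_apply _
  have h3 := continuous_centeredNorm.comp h1
  have h4 := continuous_centeredNorm.comp h2
  have h5 : Continuous fun z : Fin (2 * n) → ℝ => ∑ i, (secondHalf z i - firstHalf z i) :=
    continuous_finsetSum _ fun i _ =>
      ((continuous_apply i).comp h2).sub ((continuous_apply i).comp h1)
  simp only [Function.comp_def] at h3 h4
  refine IsOpen.union (s₁ := {z | 3.05 * centeredNorm (firstHalf z) + 2.83 * √t + 1.9
    < centeredNorm (secondHalf z)}) (s₂ := {z | (2.91 * centeredNorm (firstHalf z) + 2) * √t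
    + 4.1 * t + 2 < s * ∑ i, (secondHalf z i - firstHalf z i)})
    (isOpen_lt (by fun_prop) h4) (isOpen_lt ?_ ?_) <;> fun_prop

/-- A double sample near one with the typical behaviour under swaps is not in the deviation set. -/
theorem notMem_deviationSet {c w : Fin (2 * n) → ℝ} {s t : ℝ} (hs : |s| = 1) (ht : 0 ≤ t)
    (hn : 25 ≤ n) (hwc : ∀ j, |w j - c j| ≤ 1 / n)
    (h1 : s * ∑ i, (secondHalf c i - firstHalf c i) ≤ √(2 * halfDistSq c * t))
    (h2 : √((halfDistSq c - 1) / 8) ≤ √((n / 2 : ℕ) * sampleVariance (firstHalf c)) + √t) :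
    w ∉ deviationSet n s t := by
  have hn' : (25 : ℝ) ≤ n := by exact_mod_cast hn
  have hn0 : (0 : ℝ) < n := by linarith
  set q := √t with hq
  have hq0 : 0 ≤ q := Real.sqrt_nonneg t
  have hqt : q ^ 2 = t := Real.sq_sqrt ht
  set T := halfDistSq c with hT
  have hT0 : 0 ≤ T := halfDistSq_nonneg c
  have hr2 : √(2 : ℝ) ≤ 1.4143 := Real.sqrt_le_iff.2 (by norm_num)
  have hr8 : √(8 : ℝ) ≤ 2.8286 := Real.sqrt_le_iff.2 (by norm_num)
  have hr80 : 0 ≤ √(8 : ℝ) := Real.sqrt_nonneg _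
  set Su := centeredNorm (firstHalf c)
  set Sw := centeredNorm (firstHalf w)
  have hSu0 : 0 ≤ Su := centeredNorm_nonneg _
  have hSw0 : 0 ≤ Sw := centeredNorm_nonneg _
  -- Coordinate errors 1 / n add up to the Euclidean error 1 / √n ≤ 1 / 5, since n ≥ 25.
  have hclose : ∀ a b : Fin n → ℝ, (∀ i, |a i - b i| ≤ 1 / n) →
      √(∑ i, (a i - b i) ^ 2) ≤ 0.2 := by
    intro a b hab
    refine Real.sqrt_le_iff.2 ⟨by norm_num, ?_⟩
    calc ∑ i, (a i - b i) ^ 2 ≤ ∑ _i : Fin n, (1 / (n : ℝ)) ^ 2 :=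
          Finset.sum_le_sum fun i _ => sq_le_sq' (abs_le.1 (hab i)).1 (abs_le.1 (hab i)).2
      _ = 1 / n := by
          rw [Finset.sum_const, Finset.card_univ, Fintype.card_fin, nsmul_eq_mul]; field_simp
      _ ≤ 0.2 ^ 2 := by
          rw [div_le_iff₀ hn0]; norm_num; linarith
  have hSuw : Su ≤ Sw + 0.2 := (centeredNorm_le_add (firstHalf c) (firstHalf w)).trans
    (add_le_add le_rfl (hclose _ _ fun i => by rw [abs_sub_comm]; exact hwc _))
  have hSvw : centeredNorm (secondHalf w) ≤ centeredNorm (secondHalf c) + 0.2 :=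
    (centeredNorm_le_add (secondHalf w) (secondHalf c)).trans
      (add_le_add le_rfl (hclose _ _ fun i => hwc _))
  have hSvu : centeredNorm (secondHalf c) ≤ Su + √T :=
    centeredNorm_le_add (secondHalf c) (firstHalf c)
  -- ⌊n/2⌋ / (n - 1) ≤ n / (2 (n - 1)) ≤ 25 / 48 for n ≥ 25. After multiplication by √8 this gives
  -- √(25/6) ≤ 2.05.
  have hmV : √((n / 2 : ℕ) * sampleVariance (firstHalf c)) ≤ Su * √(25 / 48) := by
    rw [sampleVariance_eq_centeredNorm_sq]
    have hm : (((n / 2 : ℕ) : ℝ)) ≤ n / 2 := Nat.cast_div_le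
    calc √((n / 2 : ℕ) * (Su ^ 2 / ((n : ℝ) - 1))) ≤ √(Su ^ 2 * (25 / 48)) := by
          apply Real.sqrt_le_sqrt
          rw [← mul_div_assoc, div_le_iff₀ (by linarith)]
          calc ((n / 2 : ℕ) : ℝ) * Su ^ 2 ≤ n / 2 * Su ^ 2 := by gcongr
            _ ≤ _ := by nlinarith [sq_nonneg Su]
      _ = _ := by rw [Real.sqrt_mul (sq_nonneg _), Real.sqrt_sq hSu0]
  have hsT : √T ≤ 2.05 * Su + 2.8286 * q + 1 := by
    have e1 : √T ≤ √8 * √((T - 1) / 8) + 1 := by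
      rw [← Real.sqrt_mul (by norm_num), mul_div_cancel₀ _ (by norm_num : (8 : ℝ) ≠ 0)]
      refine Real.sqrt_le_iff.2 ⟨by positivity, ?_⟩
      have h := Real.sqrt_nonneg (T - 1)
      rcases le_total 0 (T - 1) with hp | hp
      · nlinarith [Real.sq_sqrt hp]
      · nlinarith
    have e2 : √8 * √((T - 1) / 8) ≤ √8 * (Su * √(25 / 48) + q) := by
      gcongr
      exact h2.trans (add_le_add hmV le_rfl)
    have e3 : √8 * √(25 / 48 : ℝ) ≤ 2.05 := by
      rw [← Real.sqrt_mul (by norm_num)]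
      exact Real.sqrt_le_iff.2 (by norm_num)
    nlinarith [mul_le_mul_of_nonneg_left e3 hSu0, mul_le_mul_of_nonneg_right hr8 hq0]
  have hsum : s * ∑ i, (secondHalf w i - firstHalf w i)
      ≤ s * ∑ i, (secondHalf c i - firstHalf c i) + 2 := by
    have e : s * ∑ i, (secondHalf w i - firstHalf w i) - s * ∑ i, (secondHalf c i - firstHalf c i)
        = ∑ i, s * ((secondHalf w i - secondHalf c i) - (firstHalf w i - firstHalf c i)) := by
      rw [← mul_sub, ← Finset.sum_sub_distrib, Finset.mul_sum]
      exact Finset.sum_congr rfl fun i _ => by ring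
    have e' : ∑ i, s * ((secondHalf w i - secondHalf c i) - (firstHalf w i - firstHalf c i))
        ≤ 2 := by
      calc _ ≤ ∑ _i : Fin n, 2 / (n : ℝ) := by
            refine Finset.sum_le_sum fun i _ => (le_abs_self _).trans ?_
            rw [abs_mul, hs, one_mul]
            refine (abs_sub _ _).trans ?_
            have h1 := hwc (finProdFinEquiv (1, i))
            have h2 := hwc (finProdFinEquiv (0, i))
            simp only [firstHalf, secondHalf]
            linarith [add_div (1 : ℝ) 1 n]
        _ = 2 := by
            rw [Finset.sum_const, Finset.card_univ, Fintype.card_fin, nsmul_eq_mul]; field_simp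
    linarith
  -- The constants of `deviationSet` come from here. First clause: 1 + 3.05 · 0.2 + 0.2 ≤ 1.9.
  -- Second clause: 1.4143 times the bound 2.05 (Sw + 0.2) + 2.8286 q + 1 on √T, with 2 added for
  -- the cover.
  rintro (h | h)
  · change 3.05 * Sw + 2.83 * q + 1.9 < _ at h
    nlinarith
  · change (2.91 * Sw + 2) * q + 4.1 * t + 2 < _ at h
    have e1 : √(2 * T * t) = √2 * √T * q := by
      rw [Real.sqrt_mul (by positivity), Real.sqrt_mul (by norm_num)]
    have e2 : √2 * √T * q ≤ 1.4143 * (2.05 * (Sw + 0.2) + 2.8286 * q + 1) * q := by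
      gcongr
      refine hsT.trans ?_
      gcongr
    nlinarith [mul_nonneg hSw0 hq0]

/-- Probability under random swaps that some member of a class of vectors with a finite cover lies
in the deviation set. -/
theorem swapLaw_exists_mem_deviationSet_le (hn : 25 ≤ n) {W : Set (Fin (2 * n) → ℝ)}
    (hW : ∀ w ∈ W, ∀ j, w j ∈ Set.Icc (0 : ℝ) 1) {C : Finset (Fin (2 * n) → ℝ)}
    (hC : ∀ w ∈ W, ∃ c ∈ C, ∀ j, |w j - c j| ≤ 1 / n) {s t : ℝ} (hs : |s| = 1) (ht : 0 ≤ t) :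
    (swapLaw n).real {σ | ∃ w ∈ W, w ∘ swapPerm σ ∈ deviationSet n s t}
      ≤ C.card * (2 * Real.exp (-t)) := by
  -- The variance tail needs values in [0, 1], but centres may come from a larger class with another
  -- range. Clamping them does not increase distances and fixes the members of W. The cover is
  -- chosen before the swaps, which only permute coordinates.
  set p : (Fin (2 * n) → ℝ) → Fin (2 * n) → ℝ := fun c j =>
    (Set.projIcc (0 : ℝ) 1 zero_le_one (c j) : ℝ) with hp
  have hp1 : ∀ c j, p c j ∈ Set.Icc (0 : ℝ) 1 := fun c j => Subtype.coe_prop _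
  set B : (Fin (2 * n) → ℝ) → Set (Fin n → Bool) := fun c =>
    {σ | √(2 * halfDistSq c * t) <
      s * ∑ i, (secondHalf (c ∘ swapPerm σ) i - firstHalf (c ∘ swapPerm σ) i)} ∪
    {σ | √((n / 2 : ℕ) * sampleVariance (firstHalf (c ∘ swapPerm σ))) + √t
      < √((halfDistSq c - 1) / 8)} with hB
  have hBle : ∀ c, (swapLaw n).real (B (p c)) ≤ 2 * Real.exp (-t) := fun c => by
    rw [two_mul]
    exact (measureReal_union_le _ _).trans (add_le_add (swapLaw_sum_sub_le _ hs ht)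
      (swapLaw_sampleVariance_lt_le (by omega) (hp1 c) ht))
  have hsub : {σ | ∃ w ∈ W, w ∘ swapPerm σ ∈ deviationSet n s t} ⊆ ⋃ c ∈ C, B (p c) := by
    rintro σ ⟨w, hw, hwσ⟩
    obtain ⟨c, hc, hwc⟩ := hC w hw
    simp only [Set.mem_iUnion]
    refine ⟨c, hc, ?_⟩
    by_contra hcon
    simp only [hB, Set.mem_union, Set.mem_ofPred_eq, not_or, not_lt] at hcon
    refine notMem_deviationSet (c := p c ∘ swapPerm σ) hs ht hn (fun j => ?_) ?_ ?_ hwσ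
    · refine le_trans ?_ (hwc (swapPerm σ j))
      have e : w (swapPerm σ j) = p w (swapPerm σ j) := by
        simp only [hp]
        rw [Set.projIcc_of_mem zero_le_one (hW w hw _)]
      have h : |p w (swapPerm σ j) - p c (swapPerm σ j)| ≤ |w (swapPerm σ j) - c (swapPerm σ j)| :=
        Set.abs_projIcc_sub_projIcc (α := ℝ) zero_le_one
      rwa [← e] at h
    · rw [halfDistSq_swap]; exact hcon.1
    · rw [halfDistSq_swap]; exact hcon.2
  calc _ ≤ (swapLaw n).real (⋃ c ∈ C, B (p c)) := measureReal_mono hsub (measure_ne_top _ _)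
    _ ≤ ∑ c ∈ C, (swapLaw n).real (B (p c)) := measureReal_biUnion_finset_le _ _
    _ ≤ ∑ _c ∈ C, 2 * Real.exp (-t) := Finset.sum_le_sum fun c _ => hBle c
    _ = _ := by rw [Finset.sum_const, nsmul_eq_mul]

end Swap

/-! ### Symmetrization -/

section Symmetrization

variable {Ω : Type*} [MeasurableSpace Ω] {P : Measure Ω} [IsProbabilityMeasure P] {n : ℕ}

/-- Serves both for the halves of a double sample and for the invariance of its law under swaps. -/
theorem map_pi_comp_injective {ι κ : Type*} [Fintype ι] [Fintype κ] {g : κ → ι}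
    (hg : Function.Injective g) :
    (Measure.pi fun _ : ι => P).map (fun z k => z (g k)) = Measure.pi fun _ : κ => P := by
  have h : iIndepFun (fun (i : ι) (z : ι → Ω) => z i) (Measure.pi fun _ : ι => P) :=
    iIndepFun_pi (μ := fun _ : ι => P) (X := fun _ => id) fun _ => aemeasurable_id
  rw [(h.precomp hg).map_fun_eq_pi_map fun k => (measurable_pi_apply _).aemeasurable]
  congr 1
  ext1 k
  exact (measurePreserving_eval (fun _ : ι => P) (g k)).map_eq

/-- The double sample with given halves. -/
def joinHalves {α : Type*} (x y : Fin n → α) (j : Fin (2 * n)) : α :=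
  if (finProdFinEquiv.symm j).1 = 0 then x (finProdFinEquiv.symm j).2
  else y (finProdFinEquiv.symm j).2

theorem firstHalf_joinHalves {α : Type*} (x y : Fin n → α) : firstHalf (joinHalves x y) = x := by
  ext i; simp [firstHalf, joinHalves]

theorem secondHalf_joinHalves {α : Type*} (x y : Fin n → α) : secondHalf (joinHalves x y) = y := by
  ext i; simp [secondHalf, joinHalves]

theorem joinHalves_halves {α : Type*} (z : Fin (2 * n) → α) :
    joinHalves (firstHalf z) (secondHalf z) = z := by
  ext j
  obtain ⟨⟨a, i⟩, rfl⟩ := finProdFinEquiv.surjective j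
  fin_cases a <;> simp [firstHalf, secondHalf, joinHalves]

theorem comp_joinHalves {α β : Type*} (f : α → β) (x y : Fin n → α) :
    (fun j => f (joinHalves x y j)) = joinHalves (fun i => f (x i)) fun i => f (y i) := by
  ext j; simp only [joinHalves]; split_ifs <;> rfl

theorem measurable_joinHalves :
    Measurable fun q : (Fin n → Ω) × (Fin n → Ω) => joinHalves q.1 q.2 := by
  refine measurable_pi_lambda _ fun j => ?_
  unfold joinHalves
  split_ifs
  · exact (measurable_pi_apply _).comp measurable_fst
  · exact (measurable_pi_apply _).comp measurable_snd

theorem measurable_firstHalf : Measurable (firstHalf : (Fin (2 * n) → Ω) → Fin n → Ω) :=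
  measurable_pi_lambda _ fun _ => measurable_pi_apply _

theorem measurable_secondHalf : Measurable (secondHalf : (Fin (2 * n) → Ω) → Fin n → Ω) :=
  measurable_pi_lambda _ fun _ => measurable_pi_apply _

theorem map_halves : (Measure.pi fun _ : Fin (2 * n) => P).map
    (fun z => (firstHalf z, secondHalf z))
      = (Measure.pi fun _ : Fin n => P).prod (Measure.pi fun _ : Fin n => P) := by
  have h : iIndepFun (fun (p : (_ : Fin 2) × Fin n) (z : Fin (2 * n) → Ω) =>
      z (finProdFinEquiv (p.1, p.2))) (Measure.pi fun _ : Fin (2 * n) => P) := by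
    refine (iIndepFun_pi (μ := fun _ : Fin (2 * n) => P) (X := fun _ => id)
      fun _ => aemeasurable_id).precomp (g := fun p : (_ : Fin 2) × Fin n =>
        finProdFinEquiv (p.1, p.2)) ?_
    rintro ⟨a, i⟩ ⟨b, j⟩ hab
    have := finProdFinEquiv.injective hab
    simp_all
  have h1 : IndepFun (firstHalf : (Fin (2 * n) → Ω) → Fin n → Ω) secondHalf
      (Measure.pi fun _ : Fin (2 * n) => P) :=
    (iIndepFun_curry (X := fun (a : Fin 2) (i : Fin n) (z : Fin (2 * n) → Ω) =>
      z (finProdFinEquiv (a, i))) (fun a i => measurable_pi_apply _) h).indepFun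
        (i := 0) (j := 1) (by decide)
  rw [(indepFun_iff_map_prod_eq_prod_map_map measurable_firstHalf.aemeasurable
    measurable_secondHalf.aemeasurable).1 h1]
  have e : ∀ a : Fin 2, (Measure.pi fun _ : Fin (2 * n) => P).map
      (fun z i => z (finProdFinEquiv (a, i))) = Measure.pi fun _ : Fin n => P := fun a =>
    map_pi_comp_injective (g := fun i : Fin n => finProdFinEquiv (a, i)) fun i j hij => by
      simpa using hij
  exact congrArg₂ Measure.prod (e 0) (e 1)

/-- The outer probability of a set of samples is controlled by the outer probability of a set of
double samples, if the latter contains a fixed proportion of the continuations of each sample in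
the former. -/
theorem measure_pi_le_mul_measure_pi_two_mul {A : Set (Fin n → Ω)} {B : Set (Fin (2 * n) → Ω)}
    {c : ℝ≥0∞} (hc0 : c ≠ 0) (hctop : c ≠ ∞)
    (h : ∀ x ∈ A, c ≤ (Measure.pi fun _ : Fin n => P) {y | joinHalves x y ∈ B}) :
    (Measure.pi fun _ : Fin n => P) A ≤ c⁻¹ * (Measure.pi fun _ : Fin (2 * n) => P) B := by
  -- Passing to a measurable hull of B leaves its measure unchanged, so neither A nor B has to be
  -- measurable; Fubini and Markov's inequality are applied to the hull.
  set B' := toMeasurable (Measure.pi fun _ : Fin (2 * n) => P) B with hB'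
  have hBm : MeasurableSet B' := measurableSet_toMeasurable _ _
  have hJ : MeasurableSet ((fun q : (Fin n → Ω) × (Fin n → Ω) => joinHalves q.1 q.2) ⁻¹' B') :=
    measurable_joinHalves hBm
  have e : (Measure.pi fun _ : Fin (2 * n) => P) B
      = ∫⁻ x, (Measure.pi fun _ : Fin n => P) {y | joinHalves x y ∈ B'}
        ∂(Measure.pi fun _ : Fin n => P) := by
    rw [← measure_toMeasurable B, ← hB']
    have : B' = (fun z => (firstHalf z, secondHalf z)) ⁻¹'
        ((fun q : (Fin n → Ω) × (Fin n → Ω) => joinHalves q.1 q.2) ⁻¹' B') := by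
      ext z; simp [joinHalves_halves]
    conv_lhs => rw [this]
    rw [← Measure.map_apply (measurable_firstHalf.prodMk measurable_secondHalf) hJ, map_halves,
      Measure.prod_apply hJ]
    rfl
  have hsub : A ⊆ {x | c ≤ (Measure.pi fun _ : Fin n => P) {y | joinHalves x y ∈ B'}} := by
    intro x hx
    refine (h x hx).trans (measure_mono fun y hy => ?_)
    exact subset_toMeasurable _ _ hy
  have hmeas : Measurable fun x => (Measure.pi fun _ : Fin n => P) {y | joinHalves x y ∈ B'} :=
    measurable_measure_prodMk_left hJ
  rw [e, mul_comm, ← div_eq_mul_inv]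
  exact (measure_mono hsub).trans (meas_ge_le_lintegral_div hmeas.aemeasurable hc0 hctop)

/-- A set of double samples that random swaps of any double sample rarely meet has small
probability. -/
theorem measure_pi_le_of_forall_swapLaw_le {B : Set (Fin (2 * n) → Ω)}
    (hB : NullMeasurableSet B (Measure.pi fun _ => P)) {c : ℝ≥0∞}
    (h : ∀ z, swapLaw n {σ | z ∘ swapPerm σ ∈ B} ≤ c) :
    (Measure.pi fun _ : Fin (2 * n) => P) B ≤ c := by
  have hmp : ∀ σ : Fin n → Bool, MeasurePreserving (fun z : Fin (2 * n) → Ω => z ∘ swapPerm σ)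
      (Measure.pi fun _ => P) (Measure.pi fun _ => P) := fun σ =>
    ⟨measurable_pi_lambda _ fun _ => measurable_pi_apply _,
      map_pi_comp_injective (swapPerm σ).injective⟩
  have hnull : ∀ σ : Fin n → Bool, NullMeasurableSet
      ((fun z : Fin (2 * n) → Ω => z ∘ swapPerm σ) ⁻¹' B) (Measure.pi fun _ => P) := fun σ =>
    hB.preimage (hmp σ).quasiMeasurePreserving
  -- Every fixed swap preserves the law, so the measure of B is the average over swaps of the
  -- measures of its preimages. Exchanging this finite average with the integral leaves the swap
  -- probability at fixed z.
  calc (Measure.pi fun _ : Fin (2 * n) => P) B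
      = ∑ σ : Fin n → Bool, swapLaw n {σ} * (Measure.pi fun _ : Fin (2 * n) => P) B := by
        rw [← Finset.sum_mul, sum_measure_singleton, Finset.coe_univ, measure_univ, one_mul]
    _ = ∑ σ : Fin n → Bool, swapLaw n {σ} * ∫⁻ z, ((fun z : Fin (2 * n) → Ω =>
          z ∘ swapPerm σ) ⁻¹' B).indicator 1 z ∂(Measure.pi fun _ => P) := by
        refine Finset.sum_congr rfl fun σ _ => ?_
        rw [lintegral_indicator_one₀ (hnull σ), (hmp σ).measure_preimage hB]
    _ = ∫⁻ z, ∑ σ : Fin n → Bool, swapLaw n {σ} * ((fun z : Fin (2 * n) → Ω =>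
          z ∘ swapPerm σ) ⁻¹' B).indicator 1 z ∂(Measure.pi fun _ => P) := by
        have hind : ∀ σ : Fin n → Bool, AEMeasurable (((fun z : Fin (2 * n) → Ω =>
            z ∘ swapPerm σ) ⁻¹' B).indicator (1 : (Fin (2 * n) → Ω) → ℝ≥0∞))
            (Measure.pi fun _ => P) := fun σ => aemeasurable_one.indicator₀ (hnull σ)
        rw [lintegral_finsetSum' _ fun σ _ => (hind σ).const_mul _]
        exact Finset.sum_congr rfl fun σ _ => (lintegral_const_mul'' _ (hind σ)).symm
    _ ≤ ∫⁻ _, c ∂(Measure.pi fun _ : Fin (2 * n) => P) := by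
        refine lintegral_mono fun z => ?_
        refine le_of_eq_of_le ?_ (h z)
        classical
        rw [← Set.coe_toFinset {σ | z ∘ swapPerm σ ∈ B}, ← sum_measure_singleton]
        rw [← Finset.sum_subset (Finset.subset_univ {σ | z ∘ swapPerm σ ∈ B}.toFinset)]
        · refine Finset.sum_congr rfl fun σ hσ => ?_
          rw [Set.mem_toFinset] at hσ
          rw [Set.indicator_of_mem (by exact hσ)]; simp
        · intro σ _ hσ
          rw [Set.mem_toFinset] at hσ
          rw [Set.indicator_of_notMem (by exact hσ), mul_zero]
    _ = c := by simp

end Symmetrization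

/-! ### The ghost sample -/

section Ghost

variable {Ω : Type*} [MeasurableSpace Ω] {P : Measure Ω} [IsProbabilityMeasure P] {n : ℕ}

/-- A case of Cantelli's inequality. -/
theorem measureReal_lt_neg_half_le {S : Type*} [MeasurableSpace S] {μ : Measure S}
    [IsProbabilityMeasure μ] {Y : S → ℝ} (hY : MemLp Y 2 μ) (h0 : ∫ s, Y s ∂μ = 0) {r : ℝ}
    (hr : 0 < r) (hv : ∫ s, Y s ^ 2 ∂μ ≤ r ^ 2) : μ.real {s | Y s < -(r / 2)} ≤ 4 / 5 := by
  have hYi : Integrable Y μ := hY.integrable (by norm_num)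
  have hY2 : Integrable (fun s => Y s ^ 2) μ := hY.integrable_sq
  have he : ∀ s, (Y s - 2 * r) ^ 2 = Y s ^ 2 - 4 * r * Y s + 4 * r ^ 2 := fun s => by ring
  have hint : Integrable (fun s => (Y s - 2 * r) ^ 2) μ := by
    simp_rw [he]
    exact (hY2.sub (hYi.const_mul _)).add (integrable_const _)
  have hval : ∫ s, (Y s - 2 * r) ^ 2 ∂μ ≤ 5 * r ^ 2 := by
    simp_rw [he]
    rw [integral_add (f := fun s => Y s ^ 2 - 4 * r * Y s) (hY2.sub (hYi.const_mul _))
      (integrable_const _), integral_sub hY2 (hYi.const_mul _), integral_const_mul, h0]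
    simp
    linarith
  -- Shifting by 2 r is optimal: Y < -r/2 forces |Y - 2 r| > 5 r / 2, and Markov's inequality gives
  -- 5 / (25/4) = 4/5.
  have hM := mul_meas_ge_le_integral_of_nonneg (ae_of_all μ fun s => sq_nonneg (Y s - 2 * r))
    hint ((5 / 2 * r) ^ 2)
  have hsub : μ.real {s | Y s < -(r / 2)} ≤ μ.real {s | (5 / 2 * r) ^ 2 ≤ (Y s - 2 * r) ^ 2} := by
    refine measureReal_mono fun s hs => ?_
    simp only [Set.mem_ofPred_eq] at hs ⊢
    nlinarith
  have hr2 : 0 < r ^ 2 := by positivity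
  have : r ^ 2 * (25 / 4 * μ.real {s | (5 / 2 * r) ^ 2 ≤ (Y s - 2 * r) ^ 2}) ≤ r ^ 2 * 5 := by
    linarith
  have := le_of_mul_le_mul_left this hr2
  linarith

theorem measure_pi_sum_lt_le {f : Ω → ℝ} (hf : Measurable f)
    (hf1 : ∀ ω, f ω ∈ Set.Icc (0 : ℝ) 1) {s : ℝ} (hs : |s| = 1) {r : ℝ} (hr : 0 < r)
    (hv : n * Var[f; P] ≤ r ^ 2) :
    (Measure.pi fun _ => P).real {y : Fin n → Ω |
      s * ∑ i, (f (y i) - ∫ ω, f ω ∂P) < -(r / 2)} ≤ 4 / 5 := by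
  have hs2 : s ^ 2 = 1 := by rw [← sq_abs, hs, one_pow]
  have hi : Integrable f P := Integrable.of_mem_Icc 0 1 hf.aemeasurable (ae_of_all _ hf1)
  set m := ∫ ω, f ω ∂P with hm
  have hgL : MemLp (fun ω => s * (f ω - m)) 2 P := by
    refine MemLp.of_bound (by fun_prop) 1 (ae_of_all _ fun ω => ?_)
    rw [Real.norm_eq_abs, abs_mul, hs, one_mul, abs_sub_comm]
    exact abs_integral_sub_le_one hf hf1 ω
  have hgL' : ∀ i : Fin n, MemLp (fun y : Fin n → Ω => s * (f (y i) - m)) 2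
      (Measure.pi fun _ => P) := fun i =>
    hgL.comp_measurePreserving (measurePreserving_eval (fun _ : Fin n => P) i)
  have hg0 : ∫ ω, s * (f ω - m) ∂P = 0 := by
    rw [integral_const_mul, integral_sub hi (integrable_const _)]
    simp [← hm]
  have hgv : Var[fun ω => s * (f ω - m); P] = Var[f; P] := by
    rw [variance_const_mul, hs2, one_mul, variance_sub_const hf.aestronglyMeasurable]
  have hsumL : MemLp (fun y : Fin n → Ω => ∑ i, s * (f (y i) - m)) 2 (Measure.pi fun _ => P) :=
    memLp_finsetSum _ fun i _ => hgL' i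
  have hsum0 : ∫ y : Fin n → Ω, ∑ i, s * (f (y i) - m) ∂(Measure.pi fun _ => P) = 0 := by
    rw [integral_finsetSum _ fun i _ => (hgL' i).integrable (by norm_num)]
    refine Finset.sum_eq_zero fun i _ => ?_
    rw [integral_comp_eval (μ := fun _ : Fin n => P) (i := i) (f := fun ω => s * (f ω - m))
      hgL.aestronglyMeasurable, hg0]
  have hvar := variance_sum_pi (μ := fun _ : Fin n => P) (X := fun _ ω => s * (f ω - m))
    fun _ => hgL
  have e : (∑ i : Fin n, fun y : Fin n → Ω => s * (f (y i) - m))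
      = fun y => ∑ i, s * (f (y i) - m) := by ext; simp
  rw [e, variance_of_integral_eq_zero hsumL.aemeasurable hsum0] at hvar
  have := measureReal_lt_neg_half_le hsumL hsum0 hr (by
    refine le_of_eq_of_le hvar ?_
    simpa [hgv] using hv)
  simpa only [Finset.mul_sum] using this

/-- If a sample deviates much from the mean, then with probability at least `1 / 5` a second sample
together with it lies in the deviation set. -/
theorem one_fifth_le_measure_pi_deviationSet (hn : 2 ≤ n) {f : Ω → ℝ} (hf : Measurable f)
    (hf1 : ∀ ω, f ω ∈ Set.Icc (0 : ℝ) 1) {s : ℝ} (hs : |s| = 1) {t : ℝ} (ht : 2 ≤ t)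
    {x : Fin n → Ω}
    (hx : √(18 * (sampleVariance fun i => f (x i)) * t / n) + 15 * t / ((n : ℝ) - 1)
      < s * (∫ ω, f ω ∂P - sampleMean fun i => f (x i))) :
    25 ≤ n ∧ (Measure.pi fun _ => P).real {y : Fin n → Ω |
      (fun j => f (joinHalves x y j)) ∉ deviationSet n s t} ≤ 4 / 5 := by
  have hn2 : (2 : ℝ) ≤ n := by exact_mod_cast hn
  have hn1 : (0 : ℝ) < n - 1 := by linarith
  have hn0 : (0 : ℝ) < n := by linarith
  have hi : Integrable f P := Integrable.of_mem_Icc 0 1 hf.aemeasurable (ae_of_all _ hf1)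
  have hle1 : s * (∫ ω, f ω ∂P - sampleMean fun i => f (x i)) ≤ 1 := by
    refine (le_abs_self _).trans ?_
    rw [abs_mul, hs, one_mul]
    have h1 := sampleMean_mem_Icc (by omega) (u := fun i => f (x i)) fun i => hf1 (x i)
    have h2 : 0 ≤ ∫ ω, f ω ∂P := integral_nonneg fun ω => (hf1 ω).1
    have h3 : ∫ ω, f ω ∂P ≤ 1 := by
      calc ∫ ω, f ω ∂P ≤ ∫ _, (1 : ℝ) ∂P :=
            integral_mono hi (integrable_const _) fun ω => (hf1 ω).2
        _ = 1 := by simp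
    rw [abs_le]
    constructor <;> linarith [h1.1, h1.2]
  -- A deviation never exceeds 1, so 15 t < n - 1. With t ≥ 2 the sample size exceeds 31.
  have hn25 : (25 : ℝ) ≤ n := by
    have h1 : 15 * t / ((n : ℝ) - 1) < 1 :=
      lt_of_le_of_lt (le_add_of_nonneg_left (Real.sqrt_nonneg _)) (hx.trans_le hle1)
    rw [div_lt_one hn1] at h1
    linarith
  refine ⟨by exact_mod_cast hn25, ?_⟩
  set m := ∫ ω, f ω ∂P with hm
  set u : Fin n → ℝ := fun i => f (x i) with hu
  set S := centeredNorm u with hS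
  set q := √t with hq
  have hS0 : 0 ≤ S := centeredNorm_nonneg _
  have hqt : q ^ 2 = t := Real.sq_sqrt (by linarith)
  have hq1 : 1.41 ≤ q := Real.le_sqrt_of_sq_le (by norm_num; linarith)
  have hhalf1 : ∀ y : Fin n → Ω, firstHalf (fun j => f (joinHalves x y j)) = u := fun y => by
    rw [comp_joinHalves, firstHalf_joinHalves]
  have hhalf2 : ∀ y : Fin n → Ω, secondHalf (fun j => f (joinHalves x y j))
      = fun i => f (y i) := fun y => by
    rw [comp_joinHalves, secondHalf_joinHalves]
  set σ := √Var[f; P] with hσ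
  have hσ0 : 0 ≤ σ := Real.sqrt_nonneg _
  -- If the true standard deviation is large compared with the spread of x, the ghost sample is
  -- widely spread with probability at least 1/5, by the variance tail at t = log (5/4). Otherwise
  -- the variance is small enough for Cantelli's inequality to keep the ghost mean near m. The
  -- constant 2.61 is 1.9 + 0.71, with √(2 log (5/4)) ≤ 0.71.
  by_cases hbig : 3.05 * S + 2.83 * q + 2.61 < √((n : ℝ) - 1) * σ
  · have h := measure_pi_sqrt_sampleVariance_lt_le (P := P) hn hf hf1
      (t := Real.log (5 / 4)) (Real.log_nonneg (by norm_num))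
    rw [Real.exp_neg, Real.exp_log (by norm_num)] at h
    refine (measureReal_mono fun y hy => ?_).trans (h.trans (by norm_num))
    simp only [Set.mem_ofPred_eq] at hy ⊢
    by_contra hcon
    apply hy
    left
    rw [hhalf1, hhalf2]
    push Not at hcon
    have h1 := mul_le_mul_of_nonneg_left hcon (Real.sqrt_nonneg ((n : ℝ) - 1))
    rw [mul_add, ← Real.sqrt_mul hn1.le (sampleVariance _), ← Real.sqrt_mul hn1.le (_ / _),
      mul_div_cancel₀ _ hn1.ne', sampleVariance_eq_centeredNorm_sq,
      mul_div_cancel₀ _ hn1.ne', Real.sqrt_sq (centeredNorm_nonneg _)] at h1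
    have h2 : √(2 * Real.log (5 / 4)) ≤ 0.71 := by
      refine Real.sqrt_le_iff.2 ⟨by norm_num, ?_⟩
      have := Real.log_le_sub_one_of_pos (show (0 : ℝ) < 5 / 4 by norm_num)
      norm_num at this ⊢
      linarith
    change 3.05 * S + 2.83 * q + 1.9 < _
    linarith
  · push Not at hbig
    set γ := 3.05 * S + 2.83 * q + 2.61 with hγ
    have hγ0 : 0 < γ := by positivity
    -- The factor 1.021 bounds √(n / (n - 1)) for n ≥ 25.
    have hv : n * Var[f; P] ≤ (1.021 * γ) ^ 2 := by
      have h1 : (n - 1) * Var[f; P] ≤ γ ^ 2 := by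
        have := pow_le_pow_left₀ (by positivity) hbig 2
        rwa [mul_pow, Real.sq_sqrt hn1.le, Real.sq_sqrt (variance_nonneg _ _)] at this
      have h2 := variance_nonneg f P
      nlinarith
    have h := measure_pi_sum_lt_le (P := P) (n := n) hf hf1 hs (r := 1.021 * γ) (by positivity) hv
    refine (measureReal_mono fun y hy => ?_).trans h
    simp only [Set.mem_ofPred_eq] at hy ⊢
    by_contra hcon
    apply hy
    right
    rw [hhalf1, hhalf2]
    push Not at hcon
    have e1 : s * ∑ i, (f (y i) - u i)
        = s * ∑ i, (f (y i) - m) + n * (s * (m - sampleMean u)) := by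
      simp only [Finset.sum_sub_distrib, Finset.sum_const, Finset.card_univ, Fintype.card_fin,
        nsmul_eq_mul]
      rw [← mul_sampleMean u]; ring
    have e2 : 4.24 * (q * S) ≤ n * √(18 * sampleVariance u * t / n) := by
      have h18 : (4.24 : ℝ) ≤ √18 := Real.le_sqrt_of_sq_le (by norm_num)
      calc 4.24 * (q * S) ≤ √18 * (q * S) := by gcongr
        _ = √(18 * (t * S ^ 2)) := by
            rw [Real.sqrt_mul (by norm_num), Real.sqrt_mul (by linarith), Real.sqrt_sq hS0]
        _ ≤ √((n : ℝ) ^ 2 * (18 * sampleVariance u * t / n)) := by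
            apply Real.sqrt_le_sqrt
            rw [sampleVariance_eq_centeredNorm_sq]
            have : (n : ℝ) ^ 2 * (18 * (S ^ 2 / (n - 1)) * t / n)
                = 18 * (t * S ^ 2) * (n / (n - 1)) := by field_simp
            rw [this]
            refine le_mul_of_one_le_right (by positivity) ?_
            rw [one_le_div hn1]; linarith
        _ = _ := by rw [Real.sqrt_mul (sq_nonneg _), Real.sqrt_sq hn0.le]
    have e3 : 15 * t ≤ n * (15 * t / (n - 1)) := by
      rw [← mul_div_assoc, le_div_iff₀ hn1]; nlinarith
    have e4 := mul_lt_mul_of_pos_left hx hn0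
    rw [mul_add] at e4
    change (2.91 * S + 2) * q + 4.1 * t + 2 < s * ∑ i, (f (y i) - u i)
    rw [e1]
    -- The difference of the sums is more than 4.24 q S + 15 t - 1.021 γ / 2; the surplus in q S and
    -- t absorbs γ because q ≥ 1.41 and t ≥ 2.
    nlinarith [mul_le_mul_of_nonneg_right hq1 hS0]

end Ghost

/-! ### The uniform empirical Bernstein inequality -/

section Uniform

variable {Ω : Type*}

theorem trace_comp_perm (K : Set (Ω → ℝ)) {m : ℕ} (z : Fin m → Ω) (τ : Equiv.Perm (Fin m)) :
    trace K (z ∘ τ) = (fun w => w ∘ τ) '' trace K z := by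
  simp only [trace, Set.image_image]; rfl

theorem exists_finset_cover {H : Set (Ω → ℝ)} {m N : ℕ} {r : ℝ≥0}
    (hN : growthFunction m r H = N) (z : Fin m → Ω) :
    ∃ C : Finset (Fin m → ℝ), C.card ≤ N ∧ ∀ w ∈ trace H z, ∃ c ∈ C, ∀ j, |w j - c j| ≤ r := by
  have hle : Metric.coveringNumber r (trace H z) ≤ N := by
    rw [← hN]; exact le_iSup (fun x : Fin m → Ω => Metric.coveringNumber r (trace H x)) z
  obtain ⟨C, -, hCfin, hC, hcard⟩ := Metric.exists_set_encard_eq_coveringNumber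
    (ne_top_of_le_ne_top (ENat.natCast_ne_top N) hle)
  refine ⟨hCfin.toFinset, ?_, fun w hw => ?_⟩
  · rw [← hcard, hCfin.encard_eq_coe_toFinset_card] at hle
    exact_mod_cast hle
  · have := Metric.isCover_iff_subset_iUnion_closedBall.1 hC hw
    simp only [Set.mem_iUnion, Metric.mem_closedBall] at this
    obtain ⟨c, hc, hwc⟩ := this
    refine ⟨c, hCfin.mem_toFinset.2 hc, fun j => ?_⟩
    rw [← Real.dist_eq]
    exact (dist_le_pi_dist w c j).trans hwc

variable [MeasurableSpace Ω] {P : Measure Ω} [IsProbabilityMeasure P] {n : ℕ}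

/-- The **uniform empirical Bernstein inequality** of Maurer and Pontil, on either side.  The
covering numbers may be those of a larger class. -/
theorem uniform_empirical_bernstein (hn : 16 ≤ n) {K H : Set (Ω → ℝ)} (hKH : K ⊆ H) {b : ℝ}
    (hb : 0 < b) (hK : ∀ f ∈ K, Measurable f) (hKb : ∀ f ∈ K, ∀ ω, f ω ∈ Set.Icc 0 b)
    (hKm : EmpiricallyMeasurable P K) {r : ℝ≥0} (hr : (r : ℝ) ≤ b / n) {s : ℝ} (hs : |s| = 1)
    {δ : ℝ} (hδ : 0 < δ) :
    (Measure.pi fun _ => P) {x : Fin n → Ω | ∃ f ∈ K, uniformBernsteinWidth b δ (fun i => f (x i))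
        < s * (∫ ω, f ω ∂P - sampleMean fun i => f (x i))}
      ≤ ((10 * growthFunction (2 * n) r H : ℕ∞) : ℝ≥0∞) * ENNReal.ofReal δ := by
  set A := {x : Fin n → Ω | ∃ f ∈ K, uniformBernsteinWidth b δ (fun i => f (x i))
        < s * (∫ ω, f ω ∂P - sampleMean fun i => f (x i))} with hA
  rcases A.eq_empty_or_nonempty with hA0 | ⟨x₀, f₀, hf₀, hx₀⟩
  · rw [hA0, measure_empty]; exact zero_le
  rcases eq_or_ne (growthFunction (2 * n) r H) ⊤ with htop | htop
  · rw [htop, ENat.mul_top (by norm_num), ENat.toENNReal_top,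
      ENNReal.top_mul (by simpa using hδ)]
    exact le_top
  obtain ⟨N, hN⟩ := ENat.ne_top_iff_exists.1 htop
  have hcast : ((10 * growthFunction (2 * n) r H : ℕ∞) : ℝ≥0∞) * ENNReal.ofReal δ
      = ENNReal.ofReal (10 * N * δ) := by
    rw [← hN, ENNReal.ofReal_mul (by positivity), ENNReal.ofReal_mul (by norm_num)]
    simp
  rw [hcast]
  rcases le_or_gt 1 (10 * N * δ) with hlarge | hsmall
  · exact prob_le_one.trans (ENNReal.one_le_ofReal.2 hlarge)
  -- A bad sample supplies both a function and points, so some trace is nonempty and needs a centre.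
  -- Then 10 N δ < 1 gives δ < 1/10, and e² < 10 gives t ≥ 2.
  have hN1 : (1 : ℝ) ≤ N := by
    obtain ⟨C, hCN, hC⟩ := exists_finset_cover hN.symm (joinHalves x₀ x₀)
    obtain ⟨c, hc, -⟩ := hC _ ⟨f₀, hKH hf₀, rfl⟩
    exact_mod_cast (Finset.card_pos.2 ⟨c, hc⟩).trans_le hCN
  have hδ10 : δ < 1 / 10 := by nlinarith
  set t := Real.log (1 / δ) with ht
  have hexp : Real.exp (-t) = δ := by
    rw [ht, Real.exp_neg, Real.exp_log (by positivity)]; simp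
  have ht2 : 2 ≤ t := by
    rw [ht, Real.le_log_iff_exp_le (by positivity)]
    have h1 : Real.exp 2 = Real.exp 1 * Real.exp 1 := by rw [← Real.exp_add]; norm_num
    have h2 := Real.exp_one_lt_d9
    have h3 : (10 : ℝ) ≤ 1 / δ := by rw [le_div_iff₀ hδ]; linarith
    nlinarith [Real.exp_pos 1]
  have hn0 : (0 : ℝ) < n := by
    have : (16 : ℝ) ≤ n := by exact_mod_cast hn
    linarith
  have hunit : ∀ f ∈ K, ∀ ω, f ω / b ∈ Set.Icc (0 : ℝ) 1 := fun f hf ω =>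
    ⟨div_nonneg (hKb f hf ω).1 hb.le, (div_le_one hb).2 (hKb f hf ω).2⟩
  set B : Set (Fin (2 * n) → Ω) :=
    {z | (trace K z ∩ (fun w j => w j / b) ⁻¹' deviationSet n s t).Nonempty} with hB
  have ghost : ∀ x ∈ A, 25 ≤ n ∧ ENNReal.ofReal (1 / 5)
      ≤ (Measure.pi fun _ : Fin n => P) {y | joinHalves x y ∈ B} := by
    rintro x ⟨f, hf, hx⟩
    have hfm := hK f hf
    obtain ⟨h25, h⟩ := one_fifth_le_measure_pi_deviationSet (P := P) (by omega)
      (f := fun ω => f ω / b) (by fun_prop) (hunit f hf) hs ht2 (x := x) (by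
        rw [uniformBernsteinWidth, ← ht] at hx
        rw [sampleVariance_div (fun i => f (x i)), sampleMean_div (fun i => f (x i)), integral_div,
          show 18 * ((sampleVariance fun i => f (x i)) / b ^ 2) * t / n
            = 18 * (sampleVariance fun i => f (x i)) * t / n / b ^ 2 by ring,
          Real.sqrt_div' _ (sq_nonneg b), Real.sqrt_sq hb.le, ← sub_div,
          mul_div_assoc' s, lt_div_iff₀ hb, add_mul, div_mul_cancel₀ _ hb.ne', mul_comm _ b]
        exact hx)
    refine ⟨h25, ?_⟩
    have hmeas : MeasurableSet {y : Fin n → Ω |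
        (fun j => f (joinHalves x y j) / b) ∈ deviationSet n s t} := by
      refine (isOpen_deviationSet s t).measurableSet.preimage (measurable_pi_lambda _ fun j => ?_)
      refine (hfm.comp ?_).div_const b
      exact (measurable_pi_apply j).comp (measurable_joinHalves.comp measurable_prodMk_left)
    have hcompl := measureReal_compl (μ := Measure.pi fun _ : Fin n => P) hmeas
    have h' : (Measure.pi fun _ : Fin n => P).real {y : Fin n → Ω |
        (fun j => f (joinHalves x y j) / b) ∈ deviationSet n s t}ᶜ ≤ 4 / 5 := h
    rw [hcompl, probReal_univ] at h'
    have h5 : 1 / 5 ≤ (Measure.pi fun _ : Fin n => P).real {y : Fin n → Ω |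
        (fun j => f (joinHalves x y j) / b) ∈ deviationSet n s t} := by linarith
    refine (ENNReal.ofReal_le_ofReal h5).trans
      ((ofReal_measureReal (measure_ne_top _ _)).le.trans (measure_mono fun y hy => ?_))
    exact ⟨fun j => f (joinHalves x y j), ⟨f, hf, rfl⟩, hy⟩
  have h25 : 25 ≤ n := (ghost x₀ ⟨f₀, hf₀, hx₀⟩).1
  -- The deviation set is open, as is its preimage under scaling; this is where empirical
  -- measurability enters.
  have hBnull : NullMeasurableSet B (Measure.pi fun _ => P) :=
    hKm (2 * n) _ ((isOpen_deviationSet s t).preimage (by fun_prop))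
  have hswap : ∀ z, swapLaw n {σ | z ∘ swapPerm σ ∈ B} ≤ ENNReal.ofReal (N * (2 * δ)) := by
    intro z
    obtain ⟨C, hCN, hC⟩ := exists_finset_cover hN.symm z
    classical
    have h := swapLaw_exists_mem_deviationSet_le h25
      (W := (fun w j => w j / b) '' trace K z) (C := C.image fun c j => c j / b) (by
        rintro _ ⟨_, ⟨f, hf, rfl⟩, rfl⟩ j
        exact hunit f hf _) (by
        rintro _ ⟨w, hw, rfl⟩
        obtain ⟨c, hc, hwc⟩ := hC w (Set.image_mono hKH hw)
        refine ⟨_, Finset.mem_image_of_mem _ hc, fun j => ?_⟩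
        rw [← sub_div, abs_div, abs_of_pos hb, div_le_iff₀ hb, one_div, mul_comm, ← div_eq_mul_inv]
        exact (hwc j).trans hr) hs (by linarith : 0 ≤ t)
    rw [hexp] at h
    rw [← ofReal_measureReal]
    refine ENNReal.ofReal_le_ofReal ?_
    calc (swapLaw n).real {σ | z ∘ swapPerm σ ∈ B} ≤ _ := by
          refine measureReal_mono fun σ hσ => ?_
          obtain ⟨w', hw', hmem⟩ := hσ
          rw [trace_comp_perm] at hw'
          obtain ⟨w, hw, rfl⟩ := hw'
          exact ⟨_, Set.mem_image_of_mem _ hw, hmem⟩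
      _ ≤ _ := h
      _ ≤ N * (2 * δ) := by
          gcongr
          exact Finset.card_image_le.trans hCN
  calc (Measure.pi fun _ => P) A
      ≤ (ENNReal.ofReal (1 / 5))⁻¹ * (Measure.pi fun _ : Fin (2 * n) => P) B :=
        measure_pi_le_mul_measure_pi_two_mul (by simp) ENNReal.ofReal_ne_top
          fun x hx => (ghost x hx).2
    _ ≤ (ENNReal.ofReal (1 / 5))⁻¹ * ENNReal.ofReal (N * (2 * δ)) := by
        gcongr
        exact measure_pi_le_of_forall_swapLaw_le hBnull hswap
    -- 10 = 5 · 2: the ghost sample costs 5, the two exceptional events per centre cost 2.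
    _ = ENNReal.ofReal (10 * N * δ) := by
        rw [← ENNReal.ofReal_inv_of_pos (by norm_num), ← ENNReal.ofReal_mul (by norm_num)]
        congr 1
        ring

end Uniform

/-! ### Bounded importance weights -/

section Weights

variable {Ω : Type*} {p : Ω → ℝ}

theorem boundedWeight_mem_Icc {rule : WeightRule} {R : ℝ} (hR : 0 < R) {q : Ω → ℝ}
    (hp : ∀ ω, 0 ≤ p ω) (hq : ∀ ω, 0 ≤ q ω) (ω : Ω) :
    boundedWeight rule R p q ω ∈ Set.Icc 0 R := by
  unfold boundedWeight
  split_ifs with h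
  · refine ⟨div_nonneg (hq ω) (hp ω), ?_⟩
    have hpos : 0 < p ω := by
      by_contra hcon
      have : p ω = 0 := le_antisymm (not_lt.1 hcon) (hp ω)
      rw [this, mul_zero] at h
      exact absurd h (not_lt.2 (hq ω))
    exact (div_le_iff₀ hpos).2 h.le
  · cases rule
    · exact ⟨le_rfl, hR.le⟩
    · exact ⟨hR.le, le_rfl⟩

/-- Below the threshold p > 0 and equality holds. Otherwise R p ≤ q, so both replacement values 0
and R keep the product below q. -/
theorem mul_boundedWeight_le {rule : WeightRule} {R : ℝ} {q : Ω → ℝ}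
    (hq : ∀ ω, 0 ≤ q ω) (ω : Ω) : p ω * boundedWeight rule R p q ω ≤ q ω := by
  unfold boundedWeight
  split_ifs with h
  · rcases eq_or_ne (p ω) 0 with h0 | h0
    · rw [h0, zero_mul]; exact hq ω
    · rw [mul_div_cancel₀ _ h0]
  · cases rule
    · simpa using hq ω
    · rw [mul_comm]; exact not_lt.1 h

variable [MeasurableSpace Ω] {ν : Measure Ω}

theorem IsDensity.isProbabilityMeasure (h : IsDensity ν p) :
    IsProbabilityMeasure (ν.withDensity fun ω => ENNReal.ofReal (p ω)) :=
  ⟨by rw [withDensity_apply _ MeasurableSet.univ, Measure.restrict_univ, h.lintegral_eq_one]⟩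

theorem IsDensity.integrable (h : IsDensity ν p) : Integrable p ν := by
  refine ⟨h.measurable.aestronglyMeasurable, ?_⟩
  rw [hasFiniteIntegral_iff_ofReal (ae_of_all _ h.nonneg), h.lintegral_eq_one]
  exact ENNReal.one_lt_top

theorem IsDensity.integral_eq_one (h : IsDensity ν p) : ∫ ω, p ω ∂ν = 1 := by
  rw [integral_eq_lintegral_of_nonneg_ae (ae_of_all _ h.nonneg)
    h.measurable.aestronglyMeasurable, h.lintegral_eq_one, ENNReal.toReal_one]

theorem IsDensity.integral_withDensity (h : IsDensity ν p) (g : Ω → ℝ) :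
    ∫ ω, g ω ∂(ν.withDensity fun ω => ENNReal.ofReal (p ω)) = ∫ ω, p ω * g ω ∂ν := by
  rw [integral_withDensity_eq_integral_toReal_smul h.measurable.ennreal_ofReal
    (ae_of_all _ fun _ => ENNReal.ofReal_lt_top)]
  simp_rw [ENNReal.toReal_ofReal (h.nonneg _), smul_eq_mul]

theorem measurable_boundedWeight {rule : WeightRule} {R : ℝ} {q : Ω → ℝ} (hp : Measurable p)
    (hq : Measurable q) : Measurable (boundedWeight rule R p q) := by
  unfold boundedWeight
  refine Measurable.ite (measurableSet_lt hq (hp.const_mul R)) (hq.div hp) ?_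
  cases rule <;> exact measurable_const

end Weights

/-! ### The bias of the bounded weights and the reduction to one-sided tails -/

namespace Setup

variable {Ω Θ : Type*} [MeasurableSpace Ω] (𝒮 : Setup Ω Θ)

instance : IsProbabilityMeasure 𝒮.P := 𝒮.density_p.isProbabilityMeasure

theorem weight_mem (θ : Θ) (ω : Ω) : 𝒮.weight θ ω ∈ Set.Icc 0 𝒮.R :=
  boundedWeight_mem_Icc 𝒮.R_pos 𝒮.density_p.nonneg (𝒮.density_q θ).nonneg ω

theorem weightedValue_mem (θ : Θ) (ω : Ω) : 𝒮.weightedValue θ ω ∈ Set.Icc 0 (𝒮.M * 𝒮.R) :=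
  ⟨mul_nonneg (𝒮.ℓ_mem ω).1 (𝒮.weight_mem θ ω).1,
    mul_le_mul (𝒮.ℓ_mem ω).2 (𝒮.weight_mem θ ω).2 (𝒮.weight_mem θ ω).1 𝒮.M_pos.le⟩

theorem measurable_weight (θ : Θ) : Measurable (𝒮.weight θ) :=
  measurable_boundedWeight 𝒮.density_p.measurable (𝒮.density_q θ).measurable

theorem measurable_weightedValue (θ : Θ) : Measurable (𝒮.weightedValue θ) :=
  𝒮.measurable_ℓ.mul (𝒮.measurable_weight θ)

theorem p_mul_weight_mem (θ : Θ) (ω : Ω) : 𝒮.p ω * 𝒮.weight θ ω ∈ Set.Icc 0 (𝒮.q θ ω) :=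
  ⟨mul_nonneg (𝒮.density_p.nonneg ω) (𝒮.weight_mem θ ω).1,
    mul_boundedWeight_le (𝒮.density_q θ).nonneg ω⟩

theorem integrable_p_mul_weight (θ : Θ) : Integrable (fun ω => 𝒮.p ω * 𝒮.weight θ ω) 𝒮.ν := by
  refine (𝒮.density_q θ).integrable.mono'
    (𝒮.density_p.measurable.mul (𝒮.measurable_weight θ)).aestronglyMeasurable
    (ae_of_all _ fun ω => ?_)
  rw [Real.norm_eq_abs, abs_of_nonneg (𝒮.p_mul_weight_mem θ ω).1]
  exact (𝒮.p_mul_weight_mem θ ω).2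

theorem integrable_ℓ_mul {g : Ω → ℝ} (hg : Integrable g 𝒮.ν) :
    Integrable (fun ω => 𝒮.ℓ ω * g ω) 𝒮.ν :=
  hg.bdd_mul (c := 𝒮.M) 𝒮.measurable_ℓ.aestronglyMeasurable (ae_of_all _ fun ω => by
    rw [Real.norm_eq_abs, abs_of_nonneg (𝒮.ℓ_mem ω).1]; exact (𝒮.ℓ_mem ω).2)

/-- The gap between the counterfactual expectation and its bounded version. -/
theorem Y_sub_Ybar (θ : Θ) :
    𝒮.Y θ - 𝒮.Ybar θ = ∫ ω, 𝒮.ℓ ω * (𝒮.q θ ω - 𝒮.p ω * 𝒮.weight θ ω) ∂𝒮.ν := by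
  have e1 : 𝒮.Y θ = ∫ ω, 𝒮.ℓ ω * 𝒮.q θ ω ∂𝒮.ν := by
    rw [Y, Q, (𝒮.density_q θ).integral_withDensity]
    simp_rw [mul_comm]
  have e2 : 𝒮.Ybar θ = ∫ ω, 𝒮.ℓ ω * (𝒮.p ω * 𝒮.weight θ ω) ∂𝒮.ν := by
    rw [Ybar, P, 𝒮.density_p.integral_withDensity]
    simp_rw [weightedValue, mul_left_comm]
  rw [e1, e2, ← integral_sub (𝒮.integrable_ℓ_mul (𝒮.density_q θ).integrable)
    (𝒮.integrable_ℓ_mul (𝒮.integrable_p_mul_weight θ))]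
  simp_rw [mul_sub]

theorem Ybar_le_Y (θ : Θ) : 𝒮.Ybar θ ≤ 𝒮.Y θ := by
  rw [← sub_nonneg, Y_sub_Ybar]
  exact integral_nonneg fun ω => mul_nonneg (𝒮.ℓ_mem ω).1
    (sub_nonneg.2 (𝒮.p_mul_weight_mem θ ω).2)

/-- The gap integrates ℓ ≤ M against q - p w̄ ≥ 0, whose total mass is the missing weight 1 - ∫ w̄
dP. -/
theorem Y_le_Ybar_add (θ : Θ) :
    𝒮.Y θ ≤ 𝒮.Ybar θ + 𝒮.M * (1 - ∫ ω, 𝒮.weight θ ω ∂𝒮.P) := by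
  have hi := (𝒮.density_q θ).integrable.sub (𝒮.integrable_p_mul_weight θ)
  rw [← sub_le_iff_le_add', Y_sub_Ybar, P, 𝒮.density_p.integral_withDensity,
    ← (𝒮.density_q θ).integral_eq_one,
    ← integral_sub (𝒮.density_q θ).integrable (𝒮.integrable_p_mul_weight θ),
    ← integral_const_mul]
  refine integral_mono (𝒮.integrable_ℓ_mul hi) (hi.const_mul _) fun ω => ?_
  exact mul_le_mul_of_nonneg_right (𝒮.ℓ_mem ω).2 (sub_nonneg.2 (𝒮.p_mul_weight_mem θ ω).2)

/-- Three one-sided deviation bounds make the intervals valid. -/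
theorem uniformlyValid_of_le {n : ℕ} (x : Fin n → Ω) {F : Set Θ} {ε ξ : Θ → ℝ}
    (h1 : ∀ θ ∈ F, 1 * (𝒮.Ybar θ - 𝒮.Yhat x θ) ≤ ε θ)
    (h2 : ∀ θ ∈ F, -1 * (𝒮.Ybar θ - 𝒮.Yhat x θ) ≤ ε θ)
    (h3 : ∀ θ ∈ F, -1 * (∫ ω, 𝒮.weight θ ω ∂𝒮.P - 𝒮.What x θ) ≤ ξ θ) :
    𝒮.UniformlyValid x F ε ξ := by
  have hinner : ∀ θ ∈ F, 𝒮.Y θ ≤ 𝒮.Ybar θ + 𝒮.M * (1 - 𝒮.What x θ + ξ θ) := by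
    intro θ hθ
    refine (𝒮.Y_le_Ybar_add θ).trans ?_
    have hM := 𝒮.M_pos
    gcongr
    linarith [h3 θ hθ]
  refine ⟨fun θ hθ => ?_, fun θ hθ => ⟨𝒮.Ybar_le_Y θ, hinner θ hθ⟩, fun θ hθ => ?_,
    fun θstar hstar hmax θ hθ => ?_⟩
  · constructor <;> linarith [h1 θ hθ, h2 θ hθ]
  · constructor <;> linarith [h1 θ hθ, h2 θ hθ, 𝒮.Ybar_le_Y θ, hinner θ hθ]
  -- Y(θ*) ≥ Ybar(θ*) ≥ Yhat(θ*) - ε(θ*) ≥ Yhat(θ) - ε(θ*) ≥ Ybar(θ) - ε(θ) - ε(θ*).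
  · have := hmax hθ
    simp only [Set.mem_ofPred_eq] at this
    linarith [h1 θ hθ, h2 θstar hstar, 𝒮.Ybar_le_Y θstar]

/-- Only an inequality, because A is arbitrary: a preimage has outer measure at most that of A under
the image law. -/
theorem measure_le_measure_pi {S : Type*} [MeasurableSpace S] {μ : Measure S} {n : ℕ}
    {P : Measure Ω} {X : Fin n → S → Ω} (hlaw : ∀ i, HasLaw (X i) P μ) (hindep : iIndepFun X μ)
    (A : Set (Fin n → Ω)) : μ {s | (fun i => X i s) ∈ A} ≤ (Measure.pi fun _ => P) A := by
  have hX : AEMeasurable (fun s i => X i s) μ :=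
    aemeasurable_pi_lambda _ fun i => (hlaw i).aemeasurable
  have hmap : μ.map (fun s i => X i s) = Measure.pi fun _ => P := by
    rw [hindep.map_fun_eq_pi_map fun i => (hlaw i).aemeasurable]
    simp_rw [(hlaw _).map_eq]
  rw [← hmap]
  exact Measure.le_map_apply hX A

/-- The probability that the intervals are not valid, from one-sided tail bounds. -/
theorem measure_not_uniformlyValid_le {S : Type*} [MeasurableSpace S] {μ : Measure S} {n : ℕ}
    {X : Fin n → S → Ω} (hlaw : ∀ i, HasLaw (X i) 𝒮.P μ) (hindep : iIndepFun X μ) (F : Set Θ)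
    (ε ξ : (Fin n → Ω) → Θ → ℝ) {c : ℝ≥0∞}
    (hε : ∀ s : ℝ, |s| = 1 → (Measure.pi fun _ => 𝒮.P) {x | ∃ θ ∈ F, ε x θ
      < s * (∫ ω, 𝒮.weightedValue θ ω ∂𝒮.P - sampleMean fun i => 𝒮.weightedValue θ (x i))} ≤ c)
    (hξ : ∀ s : ℝ, |s| = 1 → (Measure.pi fun _ => 𝒮.P) {x | ∃ θ ∈ F, ξ x θ
      < s * (∫ ω, 𝒮.weight θ ω ∂𝒮.P - sampleMean fun i => 𝒮.weight θ (x i))} ≤ c) :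
    μ {s | ¬ 𝒮.UniformlyValid (fun i => X i s) F (ε fun i => X i s) (ξ fun i => X i s)}
      ≤ 3 * c := by
  refine (measure_le_measure_pi hlaw hindep
    {x | ¬ 𝒮.UniformlyValid x F (ε x) (ξ x)}).trans ?_
  refine (measure_mono fun x hx => ?_).trans ((measure_union_le _ _).trans
    (add_le_add ((measure_union_le _ _).trans
      (add_le_add (hε 1 (by norm_num)) (hε (-1) (by norm_num)))) (hξ (-1) (by norm_num)))) |>.trans
    (le_of_eq (by ring))
  by_contra hcon
  simp only [Set.mem_union, Set.mem_ofPred_eq, not_or, not_exists, not_and, not_lt] at hcon hx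
  exact hx (𝒮.uniformlyValid_of_le x hcon.1.1 hcon.1.2 hcon.2)

theorem three_mul_ofReal_div_three (δ : ℝ) :
    3 * ENNReal.ofReal (δ / 3) = ENNReal.ofReal δ := by
  rw [← ENNReal.ofReal_ofNat, ← ENNReal.ofReal_mul (by norm_num)]
  congr 1
  ring

end Setup

end Counterfactual

end

/-! ### The main theorem -/

open Counterfactual in
theorem mainTheorem3 {Ω Θ S : Type*} [MeasurableSpace Ω] [MeasurableSpace S]
    (𝒮 : Counterfactual.Setup Ω Θ) (F : Set Θ)
    (μ : Measure S) [IsProbabilityMeasure μ] (n : ℕ) (X : Fin n → S → Ω)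
    (hlaw : ∀ i, HasLaw (X i) 𝒮.P μ) (hindep : iIndepFun X μ) :
    -- finite families
    (F.Finite → 2 ≤ n →
      (∀ δ : ℝ, 0 < δ →
        μ {s | ¬ 𝒮.UniformlyValid (fun i => X i s) F
            (𝒮.outerWidth (fun i => X i s) δ) (𝒮.innerWidth (fun i => X i s) δ)}
          ≤ (F.ncard : ℝ≥0∞) * ENNReal.ofReal δ) ∧
      (∀ δ : ℝ, 0 < δ → δ ≤ 1 → ∀ (x : Fin n → Ω) (θ : Θ),
        𝒮.outerWidth x δ θ ≤ 7 * (𝒮.M * 𝒮.R) * Real.log (6 / δ) / √n ∧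
        𝒮.innerWidth x δ θ ≤ 7 * 𝒮.R * Real.log (6 / δ) / √n)) ∧
    -- arbitrary families
    (Counterfactual.EmpiricallyMeasurable 𝒮.P (𝒮.valueClass F) →
      Counterfactual.EmpiricallyMeasurable 𝒮.P (𝒮.weightClass F) → 16 ≤ n →
      (∀ r : ℝ≥0, (r : ℝ) ≤ 𝒮.M * 𝒮.R / n → (r : ℝ) ≤ 𝒮.R / n → ∀ δ : ℝ, 0 < δ →
        μ {s | ¬ 𝒮.UniformlyValid (fun i => X i s) F
            (𝒮.uniformOuterWidth (fun i => X i s) δ) (𝒮.uniformInnerWidth (fun i => X i s) δ)}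
          ≤ (𝒮.capacity F n r : ℝ≥0∞) * ENNReal.ofReal δ) ∧
      (∀ δ : ℝ, 0 < δ → δ ≤ 1 → ∀ (x : Fin n → Ω) (θ : Θ),
        𝒮.uniformOuterWidth x δ θ ≤ 7 * (𝒮.M * 𝒮.R) * Real.log (3 / δ) / √n ∧
        𝒮.uniformInnerWidth x δ θ ≤ 7 * 𝒮.R * Real.log (3 / δ) / √n)) := by
  have hMR : 0 < 𝒮.M * 𝒮.R := mul_pos 𝒮.M_pos 𝒮.R_pos
  -- The bound holds because c / δ ≥ 3 > e.
  have hlog : ∀ {c δ : ℝ}, 3 ≤ c → 0 < δ → δ ≤ 1 → 1 ≤ Real.log (c / δ) := by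
    intro c δ hc hδ hδ1
    rw [Real.le_log_iff_exp_le (by positivity), le_div_iff₀ hδ]
    nlinarith [Real.exp_one_lt_d9]
  refine ⟨fun hF hn => ⟨fun δ hδ => ?_, fun δ hδ hδ1 x θ => ?_⟩,
    fun hval hwt hn => ⟨fun r hr1 hr2 δ hδ => ?_, fun δ hδ hδ1 x θ => ?_⟩⟩
  · have hδ3 : 0 < δ / 3 := by positivity
    have hunion : ∀ A : Θ → Set (Fin n → Ω), (∀ θ, (Measure.pi fun _ => 𝒮.P) (A θ)
        ≤ ENNReal.ofReal (δ / 3)) → (Measure.pi fun _ => 𝒮.P) {x | ∃ θ ∈ F, x ∈ A θ}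
          ≤ F.ncard * ENNReal.ofReal (δ / 3) := by
      intro A hA
      have e : {x | ∃ θ ∈ F, x ∈ A θ} = ⋃ θ ∈ hF.toFinset, A θ := by ext; simp
      rw [e, Set.ncard_eq_toFinset_card F hF, ← nsmul_eq_mul, ← Finset.sum_const]
      exact (measure_biUnion_finset_le _ _).trans (Finset.sum_le_sum fun θ _ => hA θ)
    refine (𝒮.measure_not_uniformlyValid_le hlaw hindep F (fun x => 𝒮.outerWidth x δ)
      (fun x => 𝒮.innerWidth x δ) (fun s hs => hunion _ fun θ => ?_)
      (fun s hs => hunion _ fun θ => ?_)).trans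
      (le_of_eq (by rw [mul_left_comm, Setup.three_mul_ofReal_div_three]))
    · exact empirical_bernstein hn (𝒮.measurable_weightedValue θ) hMR (𝒮.weightedValue_mem θ) hs hδ3
    · exact empirical_bernstein hn (𝒮.measurable_weight θ) 𝒮.R_pos (𝒮.weight_mem θ) hs hδ3
  · have e : 2 / (δ / 3) = 6 / δ := by field_simp; norm_num
    have hL : 1 ≤ Real.log (2 / (δ / 3)) := by rw [e]; exact hlog (by norm_num) hδ hδ1
    rw [← e]
    exact ⟨bernsteinWidth_le hn hMR.le (fun i => 𝒮.weightedValue_mem θ _) hL,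
      bernsteinWidth_le hn 𝒮.R_pos.le (fun i => 𝒮.weight_mem θ _) hL⟩
  · have hδ3 : 0 < δ / 3 := by positivity
    refine (𝒮.measure_not_uniformlyValid_le hlaw hindep F (fun x => 𝒮.uniformOuterWidth x δ)
      (fun x => 𝒮.uniformInnerWidth x δ) (c := 𝒮.capacity F n r * ENNReal.ofReal (δ / 3))
      (fun s hs => ?_) (fun s hs => ?_)).trans
      (le_of_eq (by rw [mul_left_comm, Setup.three_mul_ofReal_div_three]))
    · refine (measure_mono ?_).trans (uniform_empirical_bernstein hn
        (Set.subset_union_left (s := 𝒮.valueClass F) (t := 𝒮.weightClass F)) hMR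
        (Set.forall_mem_image.2 fun θ _ => 𝒮.measurable_weightedValue θ)
        (Set.forall_mem_image.2 fun θ _ => 𝒮.weightedValue_mem θ) hval hr1 hs hδ3)
      rintro x ⟨θ, hθ, hx⟩
      exact ⟨_, ⟨θ, hθ, rfl⟩, hx⟩
    · refine (measure_mono ?_).trans (uniform_empirical_bernstein hn
        (Set.subset_union_right (s := 𝒮.valueClass F) (t := 𝒮.weightClass F)) 𝒮.R_pos
        (Set.forall_mem_image.2 fun θ _ => 𝒮.measurable_weight θ)
        (Set.forall_mem_image.2 fun θ _ => 𝒮.weight_mem θ) hwt hr2 hs hδ3)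
      rintro x ⟨θ, hθ, hx⟩
      exact ⟨_, ⟨θ, hθ, rfl⟩, hx⟩
  · have e : 1 / (δ / 3) = 3 / δ := by field_simp
    have hL : 1 ≤ Real.log (1 / (δ / 3)) := by rw [e]; exact hlog le_rfl hδ hδ1
    rw [← e]
    exact ⟨uniformBernsteinWidth_le hn hMR.le (fun i => 𝒮.weightedValue_mem θ _) hL,
      uniformBernsteinWidth_le hn 𝒮.R_pos.le (fun i => 𝒮.weight_mem θ _) hL⟩
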